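/- **Setting.** Let $n,m,l,n_{v_g},n_g,n_{v_\eta},n_\eta,n_\omega,n_f\ge 0$ and $r\ge 1$ be integers, let $A,B_f,B_\omega,S_g,S_\eta,V_g,V_\eta,C,D_f$ be real matrices of the sizes fitting the plant with zero measurement noise $$\dot x=Ax+B_uu+S_g\,g(V_gx,u,t)+S_\eta\,\eta(V_\eta x,u,t)+B_ff+B_\omega\omega,\qquad y=Cx+D_ff,$$ let $\eta_{l}$ be a model of the uncertainty $\eta$ and $\delta\eta=\eta-\eta_l$. With $x_a=(x,f,f^{(1)},\dots,f^{(r-1)})\in\mathbb R^{n_z}$, $n_z=n+rn_f$, $\omega_a=(\delta\eta,\omega,f^{(r)})$, put $$A_a=\begin{bmatrix}A&B_f&0&\cdots&0\\0&0&I&\cdots&0\\ \vdots&&&\ddots&\vdots\\0&0&0&\cdots&I\\0&0&0&\cdots&0\end{bmatrix},\quad S_{g_a}=\begin{bmatrix}S_g&S_\eta\\0&0\end{bmatrix},\quad V_{g_a}=\begin{bmatrix}V_g&0\\V_\eta&0\end{bmatrix},\quad B_{\omega_a}=\begin{bmatrix}S_\eta&B_\omega&0\\0&0&0\\0&0&I_{n_f}\end{bmatrix},$$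 $C_a=[\,C\;D_f\;0\,]$, $\bar C=[\,0_{n_f\times n}\;I_{n_f}\;0\,]$, and $g_a(v,u,t)=\big(g(v_1,u,t),\eta_l(v_2,u,t)\big)$ for $v=(v_1,v_2)$. Assume that for some $\alpha\ge 0$ one has $\|g_a(v,u,t)-g_a(v',u,t)\|\le\alpha\|v-v'\|$ for all $v,v',u$ and all $t\ge 0$. For gains $E,K\in\mathbb R^{n_z\times m}$, $J\in\mathbb R^{(n_{v_g}+n_{v_\eta})\times m}$ let $M=I+EC_a$, $N=MA_a-KC_a$, and consider the estimation error dynamics $$\dot e=Ne+MS_{g_a}\,\delta g_a-MB_{\omega_a}\omega_a,\qquad e_f=\bar Ce,$$ $$\delta g_a=g_a\big(V_{g_a}\hat x_a+J(y-C_a\hat x_a),u,t\big)-g_a(V_{g_a}x_a,u,t),\qquad \hat x_a=x_a+e,\quad y=C_ax_a.$$ Its $\mathcal L_2$-gain from $\omega_a$ to the fault estimation error $e_f$ is said to be at most $\lambda$ if $\int_0^T\|e_f\|^2dt\le\lambda^2\int_0^T\|\omega_a\|^2dt$ for all $T\ge0$, all $\omega_a\in\mathcal L_2(0,T)$, all signals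 $x_a,u$ and all solutions $e$ on $[0,T]$ with $e(0)=0$. For $P=P^T\in\mathbb R^{n_z\times n_z}$ and $R,Q\in\mathbb R^{n_z\times m}$ let $$S_{11}=A_a^TP+A_a^TC_a^TR^T-C_a^TQ^T+PA_a+RC_aA_a-QC_a,$$ $$X_{11}=S_{11}+\alpha\,(V_{g_a}^TV_{g_a}-V_{g_a}^TJC_a-C_a^TJ^TV_{g_a}),\qquad X_{12}=\big[\sqrt{2\alpha}\,(P+RC_a)S_{g_a}\;\;\;\sqrt\alpha\,C_a^TJ^T\big].$$ **Statement.** (i) If $a>0$, $\rho\ge0$, $P\succ0$, $R$, $Q$, $J$ satisfy $$\begin{bmatrix}X_{11}+a\bar C^T\bar C&-(P+RC_a)B_{\omega_a}&X_{12}\\ *&-\rho aI&0\\ *&*&-I\end{bmatrix}\preceq0,\tag{1}$$ then, with $E=P^{-1}R$, $K=P^{-1}Q$ and this $J$, the $\mathcal L_2$-gain from $\omega_a=(\delta\eta,\omega,f^{(r)})$ to $e_f$ is at most $\sqrt\rho$. (ii) Let $\alpha=0$. Then, for $a>0$, $\rho\ge 0$ and $P\succ0$, (1) holds for $(P,R,Q,J,\rho)$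 if and only if the inequality $$\begin{bmatrix}S_{11}+\bar C^T\bar C&(P+RC_a)B_{\omega_a}\\ *&-\rho I\end{bmatrix}\preceq0\tag{2}$$ holds for $(P/a,R/a,Q/a,\rho)$. If $P\succ0$, $R$, $Q$, $\rho\ge0$ satisfy (2), then for $E=P^{-1}R$, $K=P^{-1}Q$ and any $J$ the $\mathcal L_2$-gain is at most $\sqrt\rho$. Moreover, for all gains $E,K,J$ such that all eigenvalues of $N$ have negative real part, and for every $\rho>0$: the $\mathcal L_2$-gain is at most $\sqrt\rho$ if and only if there is $P\succ0$ such that (2) holds with $R=PE$ and $Q=PK$. -/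

import Mathlib

open scoped Matrix

noncomputable section

namespace FaultEst

/-- Data of the uncertain nonlinear plant
`x' = A x + B_u u + S_g g(V_g x, u, t) + S_η η(V_η x, u, t) + B_f f + B_ω ω`, `y = C x + D_f f + D_ν ν`,
together with the prior model `ηl` of the uncertainty `η`. The matrices `B_u` and `D_ν` do not occur
in the estimation error dynamics for `ν = 0` and are not recorded. -/
structure Plant (n m l nvg ng nvη nη nω nf : ℕ) where
  A : Matrix (Fin n) (Fin n) ℝ
  Sg : Matrix (Fin n) (Fin ng) ℝ
  Vg : Matrix (Fin nvg) (Fin n) ℝ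
  Sη : Matrix (Fin n) (Fin nη) ℝ
  Vη : Matrix (Fin nvη) (Fin n) ℝ
  Bf : Matrix (Fin n) (Fin nf) ℝ
  Bω : Matrix (Fin n) (Fin nω) ℝ
  C : Matrix (Fin m) (Fin n) ℝ
  Df : Matrix (Fin m) (Fin nf) ℝ
  g : (Fin nvg → ℝ) → (Fin l → ℝ) → ℝ → (Fin ng → ℝ)
  ηl : (Fin nvη → ℝ) → (Fin l → ℝ) → ℝ → (Fin nη → ℝ)

/-- Index set of the augmented state `x_a = (x, ζ_1, …, ζ_r)`; the pair `(j, k)` is the `k`-th entry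
of `ζ_{j+1}`. -/
abbrev St (n r nf : ℕ) := Fin n ⊕ (Fin r × Fin nf)

/-- Index set of the disturbance `ω_a = (δη, ω, f^(r))`. -/
abbrev Dist (nη nω nf : ℕ) := Fin nη ⊕ (Fin nω ⊕ Fin nf)

/-- Euclidean norm of a real vector. -/
def enorm2 {ι : Type} [Fintype ι] (v : ι → ℝ) : ℝ := ‖(WithLp.toLp 2 v : EuclideanSpace ℝ ι)‖

/-- `M ≼ 0` (symmetric and negative semidefinite). -/
def NegSemidef {ι : Type} [Fintype ι] (M : Matrix ι ι ℝ) : Prop := (-M).PosSemidef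

/-- All complex eigenvalues of a real square matrix have negative real part. -/
def Hurwitz {ι : Type} [Fintype ι] [DecidableEq ι] (M : Matrix ι ι ℝ) : Prop :=
  ∀ μ ∈ spectrum ℂ (M.map (fun x : ℝ => (x : ℂ))), μ.re < 0

namespace Plant

variable {n m l nvg ng nvη nη nω nf : ℕ} (S : Plant n m l nvg ng nvη nη nω nf) (r : ℕ)

/-- `A_a`: `x' = A x + B_f ζ_1 + …`, `ζ_j' = ζ_{j+1}` for `j < r`, and zero last block row. -/
def Aa : Matrix (St n r nf) (St n r nf) ℝ :=
  Matrix.fromBlocks S.A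
    (Matrix.of fun i q => if (q.1 : ℕ) = 0 then S.Bf i q.2 else 0)
    0
    (Matrix.of fun p q => if (p.1 : ℕ) + 1 = (q.1 : ℕ) ∧ p.2 = q.2 then 1 else 0)

/-- `S_{g_a} = [S_g S_η; 0 0]`. -/
def Sga : Matrix (St n r nf) (Fin ng ⊕ Fin nη) ℝ :=
  Matrix.fromBlocks S.Sg S.Sη 0 0

/-- `V_{g_a} = [V_g 0; V_η 0]`. -/
def Vga : Matrix (Fin nvg ⊕ Fin nvη) (St n r nf) ℝ :=
  Matrix.fromBlocks S.Vg 0 S.Vη 0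

/-- `B_{ω_a} = [S_η B_ω 0; 0 0 0; 0 0 I]`. -/
def Bωa : Matrix (St n r nf) (Dist nη nω nf) ℝ :=
  Matrix.fromBlocks S.Sη (Matrix.fromCols S.Bω 0) 0
    (Matrix.fromCols 0
      (Matrix.of fun p k => if (p.1 : ℕ) + 1 = r ∧ p.2 = k then 1 else 0))

/-- `C_a = [C D_f 0]`. -/
def Ca : Matrix (Fin m) (St n r nf) ℝ :=
  Matrix.fromCols S.C (Matrix.of fun i q => if (q.1 : ℕ) = 0 then S.Df i q.2 else 0)

/-- The stacked nonlinearity `g_a = (g, ηl)`. -/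
def ga (v : Fin nvg ⊕ Fin nvη → ℝ) (u : Fin l → ℝ) (t : ℝ) : Fin ng ⊕ Fin nη → ℝ :=
  Sum.elim (S.g (fun i => v (Sum.inl i)) u t) (S.ηl (fun i => v (Sum.inr i)) u t)

/-- `g_a` is globally Lipschitz in its first argument with constant `α`, uniformly in `u` and
`t ≥ 0`. -/
def GaLipschitz (α : ℝ) : Prop :=
  ∀ (v v' : Fin nvg ⊕ Fin nvη → ℝ) (u : Fin l → ℝ) (t : ℝ), 0 ≤ t →
    enorm2 (S.ga v u t - S.ga v' u t) ≤ α * enorm2 (v - v')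

/-- `M = I + E C_a`. -/
def Mmat (E : Matrix (St n r nf) (Fin m) ℝ) : Matrix (St n r nf) (St n r nf) ℝ :=
  1 + E * S.Ca r

/-- `N = M A_a - K C_a`. -/
def Nmat (E K : Matrix (St n r nf) (Fin m) ℝ) : Matrix (St n r nf) (St n r nf) ℝ :=
  S.Mmat r E * S.Aa r - K * S.Ca r

/-- Right-hand side at time `t` of the estimation error dynamics for `ν = 0`,
`N e + M S_{g_a} δg_a - M B_{ω_a} ω_a`, where
`δg_a = g_a(V_{g_a} x̂ + J (y - C_a x̂), u, t) - g_a(V_{g_a} x, u, t)`, `x̂ = x + e`, `y = C_a x`. -/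
def errRhs (E K : Matrix (St n r nf) (Fin m) ℝ) (J : Matrix (Fin nvg ⊕ Fin nvη) (Fin m) ℝ)
    (x : St n r nf → ℝ) (u : Fin l → ℝ) (e : St n r nf → ℝ) (w : Dist nη nω nf → ℝ) (t : ℝ) :
    St n r nf → ℝ :=
  S.Nmat r E K *ᵥ e
    + (S.Mmat r E * S.Sga r) *ᵥ
        (S.ga (S.Vga r *ᵥ (x + e) + J *ᵥ (S.Ca r *ᵥ x - S.Ca r *ᵥ (x + e))) u t
          - S.ga (S.Vga r *ᵥ x) u t)
    - (S.Mmat r E * S.Bωa r) *ᵥ w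

/-- `e` is a (Caratheodory) solution on `[0, T]` of the estimation error dynamics for `ν = 0`, with
augmented plant state `x`, known input `u` and disturbance `w = ω_a`. -/
def IsErrSol (E K : Matrix (St n r nf) (Fin m) ℝ) (J : Matrix (Fin nvg ⊕ Fin nvη) (Fin m) ℝ)
    (T : ℝ) (x : ℝ → St n r nf → ℝ) (u : ℝ → Fin l → ℝ) (w : ℝ → Dist nη nω nf → ℝ)
    (e : ℝ → St n r nf → ℝ) : Prop :=
  IntervalIntegrable (fun s => S.errRhs r E K J (x s) (u s) (e s) (w s) s)
      MeasureTheory.volume 0 T ∧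
    ∀ t ∈ Set.Icc 0 T, e t = e 0 + ∫ s in (0 : ℝ)..t, S.errRhs r E K J (x s) (u s) (e s) (w s) s

end Plant

/-- `C̄ = [0 I 0]`, selecting the fault estimation error `e_f` from `e`. -/
def Cbar (n r nf : ℕ) : Matrix (Fin nf) (St n r nf) ℝ :=
  Matrix.fromCols 0 (Matrix.of fun k q => if (q.1 : ℕ) = 0 ∧ k = q.2 then 1 else 0)

namespace Plant

variable {n m l nvg ng nvη nη nω nf : ℕ} (S : Plant n m l nvg ng nvη nη nω nf) (r : ℕ)

/-- The error dynamics for `ν = 0` has `L₂`-gain at most `lam` from `ω_a` to `e_f = C̄ e`: for every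
horizon `T ≥ 0`, every `ω_a ∈ L₂(0, T)` and every solution with zero initial error,
`∫₀ᵀ ‖e_f‖² ≤ lam² ∫₀ᵀ ‖ω_a‖²`. The signals `x` and `u` entering `δg_a` are arbitrary; in particular
`x` may be any trajectory of the augmented plant. -/
def L2GainLE (E K : Matrix (St n r nf) (Fin m) ℝ) (J : Matrix (Fin nvg ⊕ Fin nvη) (Fin m) ℝ)
    (lam : ℝ) : Prop :=
  ∀ (T : ℝ), 0 ≤ T → ∀ w : ℝ → Dist nη nω nf → ℝ,
    MeasureTheory.MemLp (fun t => (WithLp.toLp 2 (w t) : EuclideanSpace ℝ (Dist nη nω nf))) 2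
      (MeasureTheory.volume.restrict (Set.Ioc 0 T)) →
    ∀ (x : ℝ → St n r nf → ℝ) (u : ℝ → Fin l → ℝ) (e : ℝ → St n r nf → ℝ),
      S.IsErrSol r E K J T x u w e → e 0 = 0 →
      ∫ t in (0 : ℝ)..T, enorm2 (Cbar n r nf *ᵥ e t) ^ 2
        ≤ lam ^ 2 * ∫ t in (0 : ℝ)..T, enorm2 (w t) ^ 2

/-- `S₁₁`. -/
def S11 (P : Matrix (St n r nf) (St n r nf) ℝ) (R Q : Matrix (St n r nf) (Fin m) ℝ) :
    Matrix (St n r nf) (St n r nf) ℝ :=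
  (S.Aa r)ᵀ * P + (S.Aa r)ᵀ * (S.Ca r)ᵀ * Rᵀ - (S.Ca r)ᵀ * Qᵀ
    + P * S.Aa r + R * S.Ca r * S.Aa r - Q * S.Ca r

/-- `X₁₁`. -/
def X11 (α : ℝ) (P : Matrix (St n r nf) (St n r nf) ℝ) (R Q : Matrix (St n r nf) (Fin m) ℝ)
    (J : Matrix (Fin nvg ⊕ Fin nvη) (Fin m) ℝ) : Matrix (St n r nf) (St n r nf) ℝ :=
  S.S11 r P R Q + α • ((S.Vga r)ᵀ * S.Vga r - (S.Vga r)ᵀ * J * S.Ca r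
    - (S.Ca r)ᵀ * Jᵀ * S.Vga r)

/-- `X₁₂ = [√(2α) (P + R C_a) S_{g_a},  √α C_aᵀ Jᵀ]`. -/
def X12 (α : ℝ) (P : Matrix (St n r nf) (St n r nf) ℝ) (R : Matrix (St n r nf) (Fin m) ℝ)
    (J : Matrix (Fin nvg ⊕ Fin nvη) (Fin m) ℝ) :
    Matrix (St n r nf) ((Fin ng ⊕ Fin nη) ⊕ (Fin nvg ⊕ Fin nvη)) ℝ :=
  Matrix.fromCols (Real.sqrt (2 * α) • ((P + R * S.Ca r) * S.Sga r))
    (Real.sqrt α • (S.Ca r)ᵀ * Jᵀ)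

/-- The `3 × 3` block matrix inequality, with blocks grouped as `((e, ω_a), rest)`. -/
def FullLMI (α a : ℝ) (P : Matrix (St n r nf) (St n r nf) ℝ) (R Q : Matrix (St n r nf) (Fin m) ℝ)
    (J : Matrix (Fin nvg ⊕ Fin nvη) (Fin m) ℝ) (ρ : ℝ) : Prop :=
  NegSemidef (Matrix.fromBlocks
    (Matrix.fromBlocks
      (S.X11 r α P R Q J + a • ((Cbar n r nf)ᵀ * Cbar n r nf)) (-((P + R * S.Ca r) * S.Bωa r))
      (-((P + R * S.Ca r) * S.Bωa r))ᵀ (-((ρ * a) • 1)))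
    (Matrix.fromRows (S.X12 r α P R J) 0)
    (Matrix.fromRows (S.X12 r α P R J) 0)ᵀ (-1))

/-- The reduced `2 × 2` block matrix inequality of the linear case. -/
def ReducedLMI (P : Matrix (St n r nf) (St n r nf) ℝ) (R Q : Matrix (St n r nf) (Fin m) ℝ)
    (ρ : ℝ) : Prop :=
  NegSemidef (Matrix.fromBlocks
    (S.S11 r P R Q + (Cbar n r nf)ᵀ * Cbar n r nf) ((P + R * S.Ca r) * S.Bωa r)
    ((P + R * S.Ca r) * S.Bωa r)ᵀ (-(ρ • 1)))

end Plant

end FaultEst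

end

noncomputable section

namespace FaultEst

open MeasureTheory

/-! ### Quadratic forms along absolutely continuous curves -/

/-! Sufficiency is a storage function argument with `V(e) = e ⬝ᵥ P *ᵥ e`. After `R = P E`, `Q = P
K`, the block inequality is a quadratic inequality in `(e, ω_a, z)`. Inserting the maximizing `z` (a
Schur complement) leaves terms that dominate `2 eᵀ P M S_{g_a} δg_a` by the Lipschitz bound and
Young's inequality. Hence `V' ≤ a (ρ ‖ω_a‖² - ‖e_f‖²)`, which is integrated from `V = 0` to `V ≥ 0`
(`dissipation_of_fullLMI`, `integral_le_of_dissipation`). For `α = 0` the `z`-part decouples, and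
dividing by `a` and changing the sign of `ω_a` gives the reduced inequality.

Necessity for `α = 0` and `N` Hurwitz is the bounded real lemma with non-strict gain and no
controllability or observability assumption (`exists_posDef_of_gain`). The natural candidate is the
available storage, the supremum of `∫ ‖C x‖² - ρ ‖w‖²` over trajectories from a given state. The
gain bound makes it finite at `0`. Linearity of the system makes the set `V` of states where it is
finite a subspace, which contains the range of `B` and is invariant under `A`. On `V` the available
storage obeys the parallelogram law, so it is a positive semidefinite quadratic form, and it is
dissipative.

Finiteness outside `V` is not known beforehand, so a solution is extended algebraically. Among the
semidefinite solutions on `V` one takes a solution of least trace: its closed loop under the worst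
disturbance has no eigenvalue in the open right half plane, since otherwise `P` could be decreased
along a left eigenvector (`re_nonpos_of_trace_minimal`). The off-diagonal block then solves a
Sylvester equation with disjoint spectra, and a large multiple of a Lyapunov form on a complement of
`V` absorbs what remains (`exists_isDissipative_of_restrict`).

The extended solution is semidefinite because `A` is stable. It becomes definite after adding a
small Lyapunov form supported on a stable spectral subspace of the closed loop that contains the
kernel of `P` (`exists_posDef_isDissipative`). -/

theorem dotProduct_mulVec_swap {ι : Type*} [Fintype ι] {P : Matrix ι ι ℝ} (hP : Pᵀ = P)
    (x y : ι → ℝ) : x ⬝ᵥ P *ᵥ y = y ⬝ᵥ P *ᵥ x := by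
  rw [Matrix.dotProduct_mulVec, ← Matrix.mulVec_transpose, hP, dotProduct_comm]

/-- Product rule for two primitives of integrable functions; absolute continuity replaces
differentiability, as the solutions are only Caratheodory solutions. -/
theorem integral_mul_of_eq_integral {T c d : ℝ} {f g : ℝ → ℝ}
    (hf : IntervalIntegrable f volume 0 T) (hg : IntervalIntegrable g volume 0 T) :
    ∫ s in (0 : ℝ)..T, (f s * (d + ∫ x in (0 : ℝ)..s, g x) + (c + ∫ x in (0 : ℝ)..s, f x) * g s)
      = (c + ∫ x in (0 : ℝ)..T, f x) * (d + ∫ x in (0 : ℝ)..T, g x) - c * d := by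
  have key : ∀ {k : ℝ} {h : ℝ → ℝ}, IntervalIntegrable h volume 0 T →
      AbsolutelyContinuousOnInterval (fun s => k + ∫ x in (0 : ℝ)..s, h x) 0 T := by
    intro k h hh
    have h1 := hh.absolutelyContinuousOnInterval_intervalIntegral (c := 0) (by simp)
    have h2 : AbsolutelyContinuousOnInterval (fun _ : ℝ => k) 0 T :=
      (LipschitzOnWith.of_dist_le_mul (K := 0) (by simp)).absolutelyContinuousOnInterval
    exact h2.add h1
  have h3 := (key (k := c) hf).integral_deriv_mul_eq_sub (key (k := d) hg)
  simp only [intervalIntegral.integral_same, add_zero] at h3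
  rw [← h3]
  apply intervalIntegral.integral_congr_ae
  filter_upwards [hf.ae_hasDerivAt_integral, hg.ae_hasDerivAt_integral] with x hx hy hxm
  have hm : x ∈ Set.uIcc 0 T := Set.uIoc_subset_uIcc hxm
  rw [((hx hm 0 (by simp)).const_add c).deriv, ((hy hm 0 (by simp)).const_add d).deriv]

theorem intervalIntegrable_sum {ι : Type*} [Fintype ι] {f : ι → ℝ → ℝ} {a b : ℝ}
    (hf : ∀ i, IntervalIntegrable (f i) volume a b) :
    IntervalIntegrable (fun s => ∑ i, f i s) volume a b := by
  simpa only [Finset.sum_fn] using IntervalIntegrable.sum Finset.univ (fun i _ => hf i)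

theorem intervalIntegrable_apply {ι : Type*} [Fintype ι] {r : ℝ → ι → ℝ} {a b : ℝ}
    (hr : IntervalIntegrable r volume a b) (i : ι) :
    IntervalIntegrable (fun s => r s i) volume a b :=
  ⟨hr.1.eval i, hr.2.eval i⟩

theorem intervalIntegral_apply {ι : Type*} [Fintype ι] {r : ℝ → ι → ℝ} {a b : ℝ}
    (hr : IntervalIntegrable r volume a b) (i : ι) :
    (∫ s in a..b, r s) i = ∫ s in a..b, r s i := by
  simp only [intervalIntegral, Pi.sub_apply]
  rw [eval_integral (fun i => hr.1.eval i), eval_integral (fun i => hr.2.eval i)]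

theorem integral_quadForm {ι : Type*} [Fintype ι] {P : Matrix ι ι ℝ} (hP : Pᵀ = P) {T : ℝ}
    (hT : 0 ≤ T) {e r : ℝ → ι → ℝ} (hr : IntervalIntegrable r volume 0 T)
    (he : ∀ t ∈ Set.Icc 0 T, e t = e 0 + ∫ s in (0 : ℝ)..t, r s) :
    IntervalIntegrable (fun s => 2 * (e s ⬝ᵥ P *ᵥ r s)) volume 0 T ∧
      ∫ s in (0 : ℝ)..T, 2 * (e s ⬝ᵥ P *ᵥ r s) = e T ⬝ᵥ P *ᵥ e T - e 0 ⬝ᵥ P *ᵥ e 0 := by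
  have hri := intervalIntegrable_apply hr
  have hF : ∀ i, ∀ t ∈ Set.Icc 0 T, e t i = e 0 i + ∫ s in (0 : ℝ)..t, r s i := by
    intro i t ht
    have hsub : IntervalIntegrable r volume 0 t :=
      hr.mono_set (by rw [Set.uIcc_of_le hT, Set.uIcc_of_le ht.1]; exact Set.Icc_subset_Icc_right ht.2)
    rw [he t ht, Pi.add_apply, intervalIntegral_apply hsub]
  have hcont : ∀ i, ContinuousOn (fun t => e 0 i + ∫ s in (0 : ℝ)..t, r s i) (Set.uIcc 0 T) :=
    fun i => continuousOn_const.add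
      (((hri i).absolutelyContinuousOnInterval_intervalIntegral (c := 0) (by simp)).continuousOn)
  have hterm : ∀ i j, IntervalIntegrable (fun s =>
      r s i * (e 0 j + ∫ x in (0 : ℝ)..s, r x j) + (e 0 i + ∫ x in (0 : ℝ)..s, r x i) * r s j)
      volume 0 T := fun i j =>
    ((hri i).mul_continuousOn (hcont j)).add ((hri j).continuousOn_mul (hcont i))
  have hpt : ∀ s ∈ Set.Icc 0 T, 2 * (e s ⬝ᵥ P *ᵥ r s) = ∑ i, ∑ j, P i j *
      (r s i * (e 0 j + ∫ x in (0 : ℝ)..s, r x j) + (e 0 i + ∫ x in (0 : ℝ)..s, r x i) * r s j) := by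
    intro s hs
    -- Symmetry of `P` splits the factor 2 into two mirrored terms, so that each pair `(i, j)` has
    -- the shape `f' g + f g'` of the product rule.
    rw [two_mul]
    nth_rewrite 2 [dotProduct_mulVec_swap hP]
    simp only [dotProduct, Matrix.mulVec, Finset.mul_sum]
    rw [← Finset.sum_add_distrib]
    refine Finset.sum_congr rfl fun i _ => ?_
    rw [← Finset.sum_add_distrib]
    refine Finset.sum_congr rfl fun j _ => ?_
    rw [← hF j s hs, ← hF i s hs]
    ring
  have hsumint : IntervalIntegrable (fun s => ∑ i, ∑ j, P i j *
      (r s i * (e 0 j + ∫ x in (0 : ℝ)..s, r x j) + (e 0 i + ∫ x in (0 : ℝ)..s, r x i) * r s j))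
      volume 0 T := by
    have : ∀ i, IntervalIntegrable (fun s => ∑ j, P i j *
      (r s i * (e 0 j + ∫ x in (0 : ℝ)..s, r x j) + (e 0 i + ∫ x in (0 : ℝ)..s, r x i) * r s j))
      volume 0 T := fun i => by
      exact intervalIntegrable_sum fun j => (hterm i j).const_mul (P i j)
    exact intervalIntegrable_sum this
  constructor
  · refine hsumint.congr fun s hs => (hpt s ?_).symm
    rw [Set.uIoc_of_le hT] at hs
    exact ⟨hs.1.le, hs.2⟩
  · rw [intervalIntegral.integral_congr (g := fun s => ∑ i, ∑ j, P i j *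
      (r s i * (e 0 j + ∫ x in (0 : ℝ)..s, r x j) + (e 0 i + ∫ x in (0 : ℝ)..s, r x i) * r s j))
      (fun s hs => hpt s (by rwa [Set.uIcc_of_le hT] at hs)),
      intervalIntegral.integral_finsetSum]
    · simp only [dotProduct, Matrix.mulVec, Finset.mul_sum]
      rw [← Finset.sum_sub_distrib]
      refine Finset.sum_congr rfl fun i _ => ?_
      rw [intervalIntegral.integral_finsetSum (fun j _ => (hterm i j).const_mul (P i j)),
        ← Finset.sum_sub_distrib]
      refine Finset.sum_congr rfl fun j _ => ?_
      rw [intervalIntegral.integral_const_mul, integral_mul_of_eq_integral (hri i) (hri j),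
        ← hF i T ⟨hT, le_rfl⟩, ← hF j T ⟨hT, le_rfl⟩]
      ring
    · intro i _
      exact intervalIntegrable_sum fun j => (hterm i j).const_mul (P i j)

end FaultEst
end

noncomputable section

namespace FaultEst

open MeasureTheory

/-! ### Matrix inequalities as inequalities between quadratic forms -/

/-- The quadratic storage function `x ⬝ᵥ P *ᵥ x` satisfies the differential dissipation inequality
of `x' = A x + B w` for the supply rate `ρ ‖w‖² - ‖C x‖²`. -/
def IsDissipative {ι κ σ : Type*} [Fintype ι] [Fintype κ] [Fintype σ] (A : Matrix ι ι ℝ)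
    (B : Matrix ι κ ℝ) (C : Matrix σ ι ℝ) (ρ : ℝ) (P : Matrix ι ι ℝ) : Prop :=
  ∀ (x : ι → ℝ) (w : κ → ℝ),
    2 * (x ⬝ᵥ P *ᵥ (A *ᵥ x + B *ᵥ w)) + (C *ᵥ x) ⬝ᵥ (C *ᵥ x) - ρ * (w ⬝ᵥ w) ≤ 0

theorem enorm2_sq {ι : Type} [Fintype ι] (v : ι → ℝ) : enorm2 v ^ 2 = v ⬝ᵥ v := by
  rw [enorm2, EuclideanSpace.norm_sq_eq]
  simp [dotProduct, sq]

theorem enorm2_nonneg {ι : Type} [Fintype ι] (v : ι → ℝ) : 0 ≤ enorm2 v := norm_nonneg _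

theorem dotProduct_le_enorm2_mul {ι : Type} [Fintype ι] (v w : ι → ℝ) :
    v ⬝ᵥ w ≤ enorm2 v * enorm2 w := by
  have h := real_inner_le_norm (WithLp.toLp 2 w : EuclideanSpace ℝ ι) (WithLp.toLp 2 v)
  rw [EuclideanSpace.inner_eq_star_dotProduct] at h
  simpa [enorm2, mul_comm] using h

theorem isHermitian_iff_transpose_eq {ι : Type*} {M : Matrix ι ι ℝ} :
    M.IsHermitian ↔ Mᵀ = M := by
  rw [Matrix.IsHermitian, Matrix.conjTranspose_eq_transpose_of_trivial]

theorem posSemidef_iff_quadForm {ι : Type*} [Fintype ι] {M : Matrix ι ι ℝ} :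
    M.PosSemidef ↔ Mᵀ = M ∧ ∀ x, 0 ≤ x ⬝ᵥ M *ᵥ x := by
  rw [Matrix.posSemidef_iff_dotProduct_mulVec, isHermitian_iff_transpose_eq]
  simp

theorem posDef_iff_quadForm {ι : Type*} [Fintype ι] {M : Matrix ι ι ℝ} :
    M.PosDef ↔ Mᵀ = M ∧ ∀ x, x ≠ 0 → 0 < x ⬝ᵥ M *ᵥ x := by
  rw [Matrix.posDef_iff_dotProduct_mulVec, isHermitian_iff_transpose_eq]
  simp

theorem negSemidef_iff_quadForm {ι : Type} [Fintype ι] {M : Matrix ι ι ℝ} :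
    NegSemidef M ↔ Mᵀ = M ∧ ∀ x, x ⬝ᵥ M *ᵥ x ≤ 0 := by
  rw [NegSemidef, posSemidef_iff_quadForm]
  simp [Matrix.neg_mulVec]

theorem quadForm_fromBlocks {ι κ : Type*} [Fintype ι] [Fintype κ] (A : Matrix ι ι ℝ)
    (B : Matrix ι κ ℝ) (D : Matrix κ κ ℝ) (x : ι → ℝ) (y : κ → ℝ) :
    Sum.elim x y ⬝ᵥ Matrix.fromBlocks A B Bᵀ D *ᵥ Sum.elim x y
      = x ⬝ᵥ A *ᵥ x + 2 * (x ⬝ᵥ B *ᵥ y) + y ⬝ᵥ D *ᵥ y := by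
  have : y ⬝ᵥ Bᵀ *ᵥ x = x ⬝ᵥ B *ᵥ y := by
    rw [Matrix.mulVec_transpose, dotProduct_comm, Matrix.dotProduct_mulVec]
  rw [Matrix.fromBlocks_mulVec]
  simp only [sumElim_dotProduct_sumElim, Sum.elim_comp_inl, Sum.elim_comp_inr,
    dotProduct_add, this]
  ring

theorem quadForm_transpose_mul_self {ι σ : Type*} [Fintype ι] [Fintype σ] (C : Matrix σ ι ℝ)
    (x : ι → ℝ) : x ⬝ᵥ (Cᵀ * C) *ᵥ x = (C *ᵥ x) ⬝ᵥ (C *ᵥ x) := by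
  rw [← Matrix.mulVec_mulVec, Matrix.mulVec_transpose, dotProduct_comm, ← Matrix.dotProduct_mulVec]

theorem negSemidef_fromBlocks_iff {ι κ : Type} [Fintype ι] [Fintype κ] {A : Matrix ι ι ℝ}
    {B : Matrix ι κ ℝ} {D : Matrix κ κ ℝ} :
    NegSemidef (Matrix.fromBlocks A B Bᵀ D) ↔ Aᵀ = A ∧ Dᵀ = D ∧
      ∀ x y, x ⬝ᵥ A *ᵥ x + 2 * (x ⬝ᵥ B *ᵥ y) + y ⬝ᵥ D *ᵥ y ≤ 0 := by
  rw [negSemidef_iff_quadForm, Matrix.fromBlocks_transpose, Matrix.fromBlocks_inj]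
  constructor
  · rintro ⟨⟨h1, -, -, h2⟩, h⟩
    exact ⟨h1, h2, fun x y => quadForm_fromBlocks A B D x y ▸ h _⟩
  · rintro ⟨h1, h2, h⟩
    refine ⟨⟨h1, by simp, rfl, h2⟩, fun x => ?_⟩
    rw [← Sum.elim_comp_inl_inr x, quadForm_fromBlocks]
    exact h _ _

/-! ### The matrix inequalities of the plant as quadratic inequalities -/

namespace Plant

variable {n m l nvg ng nvη nη nω nf : ℕ} (S : Plant n m l nvg ng nvη nη nω nf) (r : ℕ)

theorem add_mul_Ca (P : Matrix (St n r nf) (St n r nf) ℝ) (E : Matrix (St n r nf) (Fin m) ℝ) :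
    P + P * E * S.Ca r = P * S.Mmat r E := by
  rw [Mmat, Matrix.mul_add, Matrix.mul_one, Matrix.mul_assoc]

/-- With `R = P E` and `Q = P K` the bilinear products of unknowns disappear into `P N`; this is why
the inequality is affine in `(P, R, Q)`. -/
theorem S11_eq {P : Matrix (St n r nf) (St n r nf) ℝ} (hP : Pᵀ = P)
    (E K : Matrix (St n r nf) (Fin m) ℝ) :
    S.S11 r P (P * E) (P * K) = P * S.Nmat r E K + (P * S.Nmat r E K)ᵀ := by
  simp only [S11, Nmat, Mmat, Matrix.transpose_mul, Matrix.transpose_add, Matrix.transpose_sub,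
    hP, Matrix.mul_add, Matrix.mul_sub, Matrix.add_mul, Matrix.mul_assoc, Matrix.one_mul]
  abel

theorem quadForm_S11 {P : Matrix (St n r nf) (St n r nf) ℝ} (hP : Pᵀ = P)
    (E K : Matrix (St n r nf) (Fin m) ℝ) (x : St n r nf → ℝ) :
    x ⬝ᵥ S.S11 r P (P * E) (P * K) *ᵥ x = 2 * (x ⬝ᵥ P *ᵥ (S.Nmat r E K *ᵥ x)) := by
  rw [S11_eq S r hP, Matrix.add_mulVec, dotProduct_add, ← Matrix.mulVec_mulVec,
    Matrix.mulVec_transpose, dotProduct_comm x (_ ᵥ* _),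
    ← Matrix.dotProduct_mulVec, ← Matrix.mulVec_mulVec]
  ring

/-- Turns the matrix inequality into a statement about the linear system `(N, M B_{ω_a}, C̄)`, to
which the bounded real lemma applies. -/
theorem reducedLMI_iff_isDissipative {P : Matrix (St n r nf) (St n r nf) ℝ} (hP : Pᵀ = P)
    (E K : Matrix (St n r nf) (Fin m) ℝ) (ρ : ℝ) :
    S.ReducedLMI r P (P * E) (P * K) ρ ↔
      IsDissipative (S.Nmat r E K) (S.Mmat r E * S.Bωa r) (Cbar n r nf) ρ P := by
  rw [ReducedLMI, negSemidef_fromBlocks_iff, add_mul_Ca]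
  have hsym : (S.S11 r P (P * E) (P * K) + (Cbar n r nf)ᵀ * Cbar n r nf)ᵀ
      = S.S11 r P (P * E) (P * K) + (Cbar n r nf)ᵀ * Cbar n r nf := by
    rw [S11_eq S r hP]
    simp only [Matrix.transpose_add, Matrix.transpose_mul, Matrix.transpose_transpose]
    abel
  simp only [hsym, true_and, IsDissipative, Matrix.transpose_neg, Matrix.transpose_smul,
    Matrix.transpose_one]
  refine forall₂_congr fun x w => ?_
  rw [Matrix.add_mulVec, dotProduct_add, quadForm_S11 S r hP, quadForm_transpose_mul_self, Matrix.neg_mulVec,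
    Matrix.smul_mulVec, Matrix.one_mulVec, dotProduct_neg, dotProduct_smul, smul_eq_mul,
    Matrix.mulVec_add, dotProduct_add, Matrix.mul_assoc, ← Matrix.mulVec_mulVec w]
  constructor <;> intro h <;> linarith

theorem X11_transpose {P : Matrix (St n r nf) (St n r nf) ℝ} (hP : Pᵀ = P) (α : ℝ)
    (E K : Matrix (St n r nf) (Fin m) ℝ) (J : Matrix (Fin nvg ⊕ Fin nvη) (Fin m) ℝ) :
    (S.X11 r α P (P * E) (P * K) J)ᵀ = S.X11 r α P (P * E) (P * K) J := by
  rw [X11, S11_eq S r hP]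
  simp only [Matrix.transpose_add, Matrix.transpose_smul, Matrix.transpose_sub,
    Matrix.transpose_mul, Matrix.transpose_transpose, Matrix.mul_assoc]
  rw [add_comm (P * S.Nmat r E K), sub_right_comm]

theorem quadForm_X11 {P : Matrix (St n r nf) (St n r nf) ℝ} (hP : Pᵀ = P) (α : ℝ)
    (E K : Matrix (St n r nf) (Fin m) ℝ) (J : Matrix (Fin nvg ⊕ Fin nvη) (Fin m) ℝ)
    (x : St n r nf → ℝ) :
    x ⬝ᵥ S.X11 r α P (P * E) (P * K) J *ᵥ x = 2 * (x ⬝ᵥ P *ᵥ (S.Nmat r E K *ᵥ x))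
      + α * ((S.Vga r *ᵥ x) ⬝ᵥ (S.Vga r *ᵥ x)
        - 2 * ((S.Vga r *ᵥ x) ⬝ᵥ (J *ᵥ (S.Ca r *ᵥ x)))) := by
  have h1 : ∀ {σ : Type} [Fintype σ] (U W : Matrix σ (St n r nf) ℝ),
      x ⬝ᵥ (Uᵀ * W) *ᵥ x = (U *ᵥ x) ⬝ᵥ (W *ᵥ x) := fun U W => by
    rw [← Matrix.mulVec_mulVec, Matrix.mulVec_transpose, dotProduct_comm,
      ← Matrix.dotProduct_mulVec, dotProduct_comm]
  rw [X11, Matrix.add_mulVec, dotProduct_add, quadForm_S11 S r hP, Matrix.smul_mulVec,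
    dotProduct_smul, smul_eq_mul, Matrix.sub_mulVec, Matrix.sub_mulVec, dotProduct_sub,
    dotProduct_sub, Matrix.mul_assoc, h1, h1, ← Matrix.transpose_mul, h1, ← Matrix.mulVec_mulVec,
    dotProduct_comm (J *ᵥ (S.Ca r *ᵥ x))]
  ring

theorem dotProduct_X12_mulVec (α : ℝ) (P : Matrix (St n r nf) (St n r nf) ℝ)
    (E : Matrix (St n r nf) (Fin m) ℝ) (J : Matrix (Fin nvg ⊕ Fin nvη) (Fin m) ℝ)
    (x : St n r nf → ℝ) (z₁ : Fin ng ⊕ Fin nη → ℝ) (z₂ : Fin nvg ⊕ Fin nvη → ℝ) :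
    x ⬝ᵥ S.X12 r α P (P * E) J *ᵥ (Sum.elim z₁ z₂) =
      √(2 * α) * (x ⬝ᵥ P *ᵥ ((S.Mmat r E * S.Sga r) *ᵥ z₁))
        + √α * ((J *ᵥ (S.Ca r *ᵥ x)) ⬝ᵥ z₂) := by
  rw [X12, Matrix.fromCols_mulVec, Sum.elim_comp_inl, Sum.elim_comp_inr, add_mul_Ca,
    dotProduct_add, Matrix.smul_mulVec, dotProduct_smul, smul_eq_mul, Matrix.smul_mul,
    Matrix.smul_mulVec, dotProduct_smul, smul_eq_mul, Matrix.mul_assoc, ← Matrix.mulVec_mulVec z₁,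
    ← Matrix.transpose_mul, Matrix.mulVec_transpose, dotProduct_comm x (_ ᵥ* _),
    ← Matrix.dotProduct_mulVec, dotProduct_comm z₂, ← Matrix.mulVec_mulVec,
    ← Matrix.mulVec_mulVec]

/-- The `3 × 3` block matrix inequality in terms of quadratic forms. -/
theorem fullLMI_iff {P : Matrix (St n r nf) (St n r nf) ℝ} (hP : Pᵀ = P) (α a : ℝ)
    (E K : Matrix (St n r nf) (Fin m) ℝ) (J : Matrix (Fin nvg ⊕ Fin nvη) (Fin m) ℝ) (ρ : ℝ) :
    S.FullLMI r α a P (P * E) (P * K) J ρ ↔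
      ∀ (x : St n r nf → ℝ) (w : Dist nη nω nf → ℝ) (z : (Fin ng ⊕ Fin nη) ⊕ (Fin nvg ⊕ Fin nvη) → ℝ),
        x ⬝ᵥ S.X11 r α P (P * E) (P * K) J *ᵥ x + a * ((Cbar n r nf *ᵥ x) ⬝ᵥ (Cbar n r nf *ᵥ x))
          - 2 * (x ⬝ᵥ P *ᵥ ((S.Mmat r E * S.Bωa r) *ᵥ w)) - ρ * a * (w ⬝ᵥ w)
          + 2 * (x ⬝ᵥ S.X12 r α P (P * E) J *ᵥ z) - z ⬝ᵥ z ≤ 0 := by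
  have hsym : (S.X11 r α P (P * E) (P * K) J + a • ((Cbar n r nf)ᵀ * Cbar n r nf))ᵀ
      = S.X11 r α P (P * E) (P * K) J + a • ((Cbar n r nf)ᵀ * Cbar n r nf) := by
    rw [Matrix.transpose_add, X11_transpose S r hP, Matrix.transpose_smul, Matrix.transpose_mul,
      Matrix.transpose_transpose]
  rw [FullLMI, negSemidef_fromBlocks_iff, Matrix.fromBlocks_transpose, hsym]
  simp only [Matrix.transpose_neg, Matrix.transpose_smul, Matrix.transpose_one,
    Matrix.transpose_transpose, true_and]
  have hexp : ∀ (x : St n r nf → ℝ) (w : Dist nη nω nf → ℝ)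
      (z : (Fin ng ⊕ Fin nη) ⊕ (Fin nvg ⊕ Fin nvη) → ℝ),
      Sum.elim x w ⬝ᵥ Matrix.fromBlocks
          (S.X11 r α P (P * E) (P * K) J + a • ((Cbar n r nf)ᵀ * Cbar n r nf))
          (-((P + P * E * S.Ca r) * S.Bωa r)) (-((P + P * E * S.Ca r) * S.Bωa r))ᵀ
          (-((ρ * a) • 1)) *ᵥ Sum.elim x w
        + 2 * (Sum.elim x w ⬝ᵥ Matrix.fromRows (S.X12 r α P (P * E) J) 0 *ᵥ z) + z ⬝ᵥ (-1) *ᵥ z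
      = x ⬝ᵥ S.X11 r α P (P * E) (P * K) J *ᵥ x + a * ((Cbar n r nf *ᵥ x) ⬝ᵥ (Cbar n r nf *ᵥ x))
          - 2 * (x ⬝ᵥ P *ᵥ ((S.Mmat r E * S.Bωa r) *ᵥ w)) - ρ * a * (w ⬝ᵥ w)
          + 2 * (x ⬝ᵥ S.X12 r α P (P * E) J *ᵥ z) - z ⬝ᵥ z := by
    intro x w z
    rw [quadForm_fromBlocks, Matrix.fromRows_mulVec, sumElim_dotProduct_sumElim, Matrix.zero_mulVec,
      dotProduct_zero, Matrix.add_mulVec, dotProduct_add, Matrix.smul_mulVec, dotProduct_smul,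
      quadForm_transpose_mul_self, add_mul_Ca, Matrix.neg_mulVec, dotProduct_neg,
      Matrix.neg_mulVec, dotProduct_neg, Matrix.smul_mulVec, dotProduct_smul, Matrix.one_mulVec,
      Matrix.neg_mulVec, dotProduct_neg, Matrix.one_mulVec, Matrix.mul_assoc P,
      ← Matrix.mulVec_mulVec w P, smul_eq_mul, smul_eq_mul]
    ring
  constructor
  · intro h x w z
    rw [← hexp]
    exact h _ _
  · intro h x z
    rw [← Sum.elim_comp_inl_inr x, ← Matrix.transpose_neg, hexp]
    exact h _ _ _

end Plant

end FaultEst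
end

noncomputable section

namespace FaultEst

open MeasureTheory

/-! ### Sufficiency of the matrix inequalities -/

theorem integrable_dotProduct_self {κ : Type} [Fintype κ] {T : ℝ} (hT : 0 ≤ T) {w : ℝ → κ → ℝ}
    (hw : MemLp (fun t => (WithLp.toLp 2 (w t) : EuclideanSpace ℝ κ)) 2
      (volume.restrict (Set.Ioc 0 T))) :
    IntervalIntegrable (fun t => w t ⬝ᵥ w t) volume 0 T := by
  rw [intervalIntegrable_iff_integrableOn_Ioc_of_le hT]
  have h := hw.integrable_norm_pow (by norm_num)
  refine h.congr (Filter.Eventually.of_forall fun t => ?_)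
  exact enorm2_sq (w t)

/-- Integrating a dissipation inequality along an absolutely continuous curve starting at `0`. -/
theorem integral_le_of_dissipation {ι κ σ : Type} [Fintype ι] [Fintype κ] [Fintype σ]
    {P : Matrix ι ι ℝ} (hP : P.PosSemidef) (C : Matrix σ ι ℝ) {a ρ : ℝ} (ha : 0 < a) {T : ℝ}
    (hT : 0 ≤ T) {e f : ℝ → ι → ℝ} {w : ℝ → κ → ℝ}
    (hw : IntervalIntegrable (fun t => w t ⬝ᵥ w t) volume 0 T)
    (hf : IntervalIntegrable f volume 0 T)
    (he : ∀ t ∈ Set.Icc 0 T, e t = e 0 + ∫ s in (0 : ℝ)..t, f s) (he0 : e 0 = 0)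
    (hdiss : ∀ t ∈ Set.Icc 0 T,
      2 * (e t ⬝ᵥ P *ᵥ f t) ≤ a * (ρ * (w t ⬝ᵥ w t) - (C *ᵥ e t) ⬝ᵥ (C *ᵥ e t))) :
    ∫ t in (0 : ℝ)..T, (C *ᵥ e t) ⬝ᵥ (C *ᵥ e t) ≤ ρ * ∫ t in (0 : ℝ)..T, w t ⬝ᵥ w t := by
  obtain ⟨hPs, hPn⟩ := posSemidef_iff_quadForm.1 hP
  obtain ⟨hint, hval⟩ := integral_quadForm hPs hT hf he
  have hcont : ContinuousOn e (Set.uIcc 0 T) := by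
    rw [Set.uIcc_of_le hT]
    refine ContinuousOn.congr ?_ he
    have := intervalIntegral.continuousOn_primitive_interval' hf (a := 0) (by simp)
    rw [Set.uIcc_of_le hT] at this
    exact continuousOn_const.add this
  have hCe : IntervalIntegrable (fun t => (C *ᵥ e t) ⬝ᵥ (C *ᵥ e t)) volume 0 T := by
    apply ContinuousOn.intervalIntegrable
    have h1 : Continuous fun v : ι → ℝ => (C *ᵥ v) ⬝ᵥ (C *ᵥ v) := by fun_prop
    exact h1.comp_continuousOn hcont
  have hmono := intervalIntegral.integral_mono_on hT hint
    (((hw.const_mul ρ).sub hCe).const_mul a) hdiss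
  rw [hval, intervalIntegral.integral_const_mul,
    intervalIntegral.integral_sub (hw.const_mul ρ) hCe, intervalIntegral.integral_const_mul, he0]
    at hmono
  have h0 := hPn (e T)
  -- Zero initial storage and nonnegative final storage leave only the supply terms; dividing by `a
  -- > 0` gives the gain.
  simp only [zero_dotProduct, sub_zero] at hmono
  have := nonneg_of_mul_nonneg_right (h0.trans hmono) ha
  linarith

/-! ### Gain bounds for the error dynamics -/

namespace Plant

variable {n m l nvg ng nvη nη nω nf : ℕ} (S : Plant n m l nvg ng nvη nη nω nf) (r : ℕ)

/-- The last block row of the inequality is a Schur complement that pays for the nonlinearity: it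
supplies the squares needed to bound `2 q ⬝ᵥ δ` by Young's inequality, where `q = (M S_{g_a})ᵀ P e`.
-/
theorem dissipation_of_fullLMI {α a ρ : ℝ} (hα : 0 ≤ α) (hLip : S.GaLipschitz α)
    {P : Matrix (St n r nf) (St n r nf) ℝ} (hP : Pᵀ = P) {E K : Matrix (St n r nf) (Fin m) ℝ}
    {J : Matrix (Fin nvg ⊕ Fin nvη) (Fin m) ℝ} (h : S.FullLMI r α a P (P * E) (P * K) J ρ)
    (x : St n r nf → ℝ) (u : Fin l → ℝ) (e : St n r nf → ℝ) (w : Dist nη nω nf → ℝ) {t : ℝ}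
    (ht : 0 ≤ t) :
    2 * (e ⬝ᵥ P *ᵥ S.errRhs r E K J x u e w t)
      ≤ a * (ρ * (w ⬝ᵥ w) - (Cbar n r nf *ᵥ e) ⬝ᵥ (Cbar n r nf *ᵥ e)) := by
  rw [fullLMI_iff S r hP] at h
  rw [errRhs, Matrix.mulVec_sub, Matrix.mulVec_add, dotProduct_sub, dotProduct_add]
  set v₁ := S.Vga r *ᵥ (x + e) + J *ᵥ (S.Ca r *ᵥ x - S.Ca r *ᵥ (x + e)) with hv₁
  set δ := S.ga v₁ u t - S.ga (S.Vga r *ᵥ x) u t with hδ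
  set c := J *ᵥ (S.Ca r *ᵥ e) with hc
  set q := (P *ᵥ e) ᵥ* (S.Mmat r E * S.Sga r) with hq
  have hqz : ∀ z, e ⬝ᵥ P *ᵥ ((S.Mmat r E * S.Sga r) *ᵥ z) = q ⬝ᵥ z := fun z => by
    rw [dotProduct_mulVec_swap hP, dotProduct_comm, hq, Matrix.dotProduct_mulVec]
  have hv : v₁ - S.Vga r *ᵥ x = S.Vga r *ᵥ e - c := by
    rw [hv₁, hc, Matrix.mulVec_add, Matrix.mulVec_add, sub_add_cancel_left, Matrix.mulVec_neg]
    abel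
  have hL := hLip v₁ (S.Vga r *ᵥ x) u t ht
  rw [← hδ, hv] at hL
  -- This `z` is the maximizer of `2 xᵀ X₁₂ z - zᵀ z`, namely `z = X₁₂ᵀ x`; the maximum is `2α ‖q‖²
  -- + α ‖c‖²`.
  have h1 := h e w (Sum.elim (√(2 * α) • q) (√α • c))
  rw [dotProduct_X12_mulVec, hqz, quadForm_X11 S r hP, sumElim_dotProduct_sumElim] at h1
  simp only [dotProduct_smul, smul_dotProduct, smul_eq_mul, ← hc] at h1
  have s1 : √(2 * α) * √(2 * α) = 2 * α := Real.mul_self_sqrt (by positivity)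
  have s2 : √α * √α = α := Real.mul_self_sqrt hα
  have e1 : √(2 * α) * (√(2 * α) * (q ⬝ᵥ q)) = 2 * α * (q ⬝ᵥ q) := by rw [← mul_assoc, s1]
  have e2 : √α * (√α * (c ⬝ᵥ c)) = α * (c ⬝ᵥ c) := by rw [← mul_assoc, s2]
  rw [e1, e2] at h1
  have hsq : enorm2 (S.Vga r *ᵥ e - c) ^ 2 = (S.Vga r *ᵥ e) ⬝ᵥ (S.Vga r *ᵥ e)
      - 2 * ((S.Vga r *ᵥ e) ⬝ᵥ c) + c ⬝ᵥ c := by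
    rw [enorm2_sq, sub_dotProduct, dotProduct_sub, dotProduct_sub, dotProduct_comm c]
    ring
  -- Lipschitz bound, Cauchy–Schwarz, then `2st ≤ s² + t²`. Only `α ‖q‖²` is consumed; the other
  -- half of the available `2α ‖q‖²` is discarded through `hqq`.
  have h2 : 2 * (q ⬝ᵥ δ) ≤ α * (q ⬝ᵥ q) + α * enorm2 (S.Vga r *ᵥ e - c) ^ 2 := by
    have h3 := dotProduct_le_enorm2_mul q δ
    have h4 := mul_le_mul_of_nonneg_left hL (enorm2_nonneg q)
    rw [← enorm2_sq]
    nlinarith [mul_nonneg hα (sq_nonneg (enorm2 q - enorm2 (S.Vga r *ᵥ e - c)))]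
  have hqq : 0 ≤ α * (q ⬝ᵥ q) := mul_nonneg hα (by rw [← enorm2_sq]; positivity)
  rw [hqz]
  rw [hsq] at h2
  linarith

/-- A positive definite solution of the `3 × 3` block matrix inequality bounds the `L₂`-gain. -/
theorem l2GainLE_of_fullLMI {α a ρ : ℝ} (hα : 0 ≤ α) (hLip : S.GaLipschitz α) (ha : 0 < a)
    (hρ : 0 ≤ ρ) {P : Matrix (St n r nf) (St n r nf) ℝ} {R Q : Matrix (St n r nf) (Fin m) ℝ}
    {J : Matrix (Fin nvg ⊕ Fin nvη) (Fin m) ℝ} (hP : P.PosDef)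
    (h : S.FullLMI r α a P R Q J ρ) : S.L2GainLE r (P⁻¹ * R) (P⁻¹ * Q) J (√ρ) := by
  have hdet : IsUnit P.det := (Matrix.isUnit_iff_isUnit_det P).1 hP.isUnit
  obtain ⟨hPs, -⟩ := posDef_iff_quadForm.1 hP
  rw [← Matrix.mul_nonsing_inv_cancel_left P R hdet, ← Matrix.mul_nonsing_inv_cancel_left P Q hdet]
    at h
  intro T hT w hw x u e he he0
  simp only [enorm2_sq, Real.sq_sqrt hρ]
  exact integral_le_of_dissipation hP.posSemidef (Cbar n r nf) ha hT
    (integrable_dotProduct_self hT hw) he.1 he.2 he0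
    fun t ht => dissipation_of_fullLMI S r hα hLip hPs h _ _ _ _ ht.1

/-- Without nonlinearity the `3 × 3` block matrix inequality is the reduced one, up to scaling. -/
theorem fullLMI_zero_iff {a ρ : ℝ} (ha : 0 < a) {P : Matrix (St n r nf) (St n r nf) ℝ}
    {R Q : Matrix (St n r nf) (Fin m) ℝ} (J : Matrix (Fin nvg ⊕ Fin nvη) (Fin m) ℝ)
    (hP : P.PosDef) :
    S.FullLMI r 0 a P R Q J ρ ↔ S.ReducedLMI r (a⁻¹ • P) (a⁻¹ • R) (a⁻¹ • Q) ρ := by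
  have hdet : IsUnit P.det := (Matrix.isUnit_iff_isUnit_det P).1 hP.isUnit
  obtain ⟨hPs, -⟩ := posDef_iff_quadForm.1 hP
  rw [← Matrix.mul_nonsing_inv_cancel_left P R hdet, ← Matrix.mul_nonsing_inv_cancel_left P Q hdet,
    ← Matrix.smul_mul, ← Matrix.smul_mul, reducedLMI_iff_isDissipative, fullLMI_iff S r hPs]
  swap
  · rw [Matrix.transpose_smul, hPs]
  have hX : S.X12 r 0 P (P * (P⁻¹ * R)) J = 0 := by
    simp [X12]
  simp only [hX, quadForm_X11 S r hPs, Matrix.zero_mulVec, dotProduct_zero, IsDissipative,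
    Matrix.smul_mulVec, dotProduct_smul, smul_eq_mul, Matrix.mulVec_add, dotProduct_add]
  have key : ∀ (A B c d : ℝ), (2 * A + 0 + a * c + 2 * B - ρ * a * d ≤ 0
      ↔ 2 * (a⁻¹ * A + a⁻¹ * B) + c - ρ * d ≤ 0) := by
    intro A B c d
    have : 2 * A + 0 + a * c + 2 * B - ρ * a * d = a * (2 * (a⁻¹ * A + a⁻¹ * B) + c - ρ * d) := by
      field_simp
      ring
    rw [this, ← not_lt, ← not_lt, mul_pos_iff_of_pos_left ha]
  constructor
  · intro h x w
    -- The off-diagonal `B` block has opposite signs in the two inequalities, which the substitution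
    -- `w ↦ -w` repairs.
    have h1 := h x (-w) 0
    simp only [Matrix.mulVec_neg, dotProduct_neg, neg_dotProduct, neg_neg, dotProduct_zero] at h1
    rw [← key]
    linarith
  · intro h x w z
    have h1 := (key _ _ _ _).2 (h x (-w))
    simp only [Matrix.mulVec_neg, dotProduct_neg, neg_dotProduct, neg_neg] at h1
    have h2 : 0 ≤ z ⬝ᵥ z := by simpa using dotProduct_star_self_nonneg z
    linarith

end Plant

end FaultEst
end

noncomputable section

namespace FaultEst

open Filter Topology

/-! ### Hurwitz matrices and the Lyapunov inequality -/

/-- The complexification of a real matrix. -/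
def toComplex {ι κ : Type*} (M : Matrix ι κ ℝ) : Matrix ι κ ℂ := M.map (fun x : ℝ => (x : ℂ))

theorem toComplex_mul {ι κ σ : Type*} [Fintype κ] (M : Matrix ι κ ℝ) (N : Matrix κ σ ℝ) :
    toComplex (M * N) = toComplex M * toComplex N := by
  ext i j
  simp [toComplex, Matrix.mul_apply]

theorem toComplex_add {ι κ : Type*} (M N : Matrix ι κ ℝ) :
    toComplex (M + N) = toComplex M + toComplex N := by
  ext i j
  simp [toComplex]

theorem toComplex_sub {ι κ : Type*} (M N : Matrix ι κ ℝ) :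
    toComplex (M - N) = toComplex M - toComplex N := by
  ext i j
  simp [toComplex]

theorem toComplex_one {ι : Type*} [DecidableEq ι] :
    toComplex (1 : Matrix ι ι ℝ) = 1 := by
  ext i j
  by_cases h : i = j <;> simp [toComplex, Matrix.one_apply, h]

theorem toComplex_smul {ι κ : Type*} (c : ℝ) (M : Matrix ι κ ℝ) :
    toComplex (c • M) = (c : ℂ) • toComplex M := by
  ext i j
  simp [toComplex]

theorem toComplex_transpose {ι κ : Type*} (M : Matrix ι κ ℝ) :
    toComplex Mᵀ = (toComplex M)ᵀ := rfl

theorem toComplex_pow {ι : Type*} [Fintype ι] [DecidableEq ι] (M : Matrix ι ι ℝ) (k : ℕ) :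
    toComplex (M ^ k) = toComplex M ^ k := by
  induction k with
  | zero => simp [toComplex_one]
  | succ k ih => rw [pow_succ, pow_succ, toComplex_mul, ih]

theorem toComplex_mulVec {ι κ : Type*} [Fintype κ] (M : Matrix ι κ ℝ) (x : κ → ℝ) :
    toComplex M *ᵥ (fun i => (x i : ℂ)) = fun i => ((M *ᵥ x) i : ℂ) := by
  ext i
  simp [toComplex, Matrix.mulVec, dotProduct]

theorem mem_spectrum_iff_mulVec {ι : Type*} [Fintype ι] [DecidableEq ι] {M : Matrix ι ι ℂ} {μ : ℂ} :
    μ ∈ spectrum ℂ M ↔ ∃ v, v ≠ 0 ∧ M *ᵥ v = μ • v := by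
  rw [spectrum.mem_iff, Matrix.isUnit_iff_isUnit_det, isUnit_iff_ne_zero, not_not,
    ← Matrix.exists_mulVec_eq_zero_iff]
  refine exists_congr fun v => and_congr_right fun _ => ?_
  rw [Matrix.sub_mulVec, sub_eq_zero, Algebra.algebraMap_eq_smul_one, Matrix.smul_mulVec,
    Matrix.one_mulVec, eq_comm]

theorem mem_spectrum_iff_vecMul {ι : Type*} [Fintype ι] [DecidableEq ι] {M : Matrix ι ι ℂ} {μ : ℂ} :
    μ ∈ spectrum ℂ M ↔ ∃ v, v ≠ 0 ∧ v ᵥ* M = μ • v := by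
  rw [spectrum.mem_iff, Matrix.isUnit_iff_isUnit_det, isUnit_iff_ne_zero, not_not,
    ← Matrix.exists_vecMul_eq_zero_iff]
  refine exists_congr fun v => and_congr_right fun _ => ?_
  rw [Matrix.vecMul_sub, sub_eq_zero, Algebra.algebraMap_eq_smul_one, Matrix.vecMul_smul,
    Matrix.vecMul_one, eq_comm]

theorem hurwitz_iff_mulVec {ι : Type} [Fintype ι] [DecidableEq ι] {M : Matrix ι ι ℝ} :
    Hurwitz M ↔ ∀ (μ : ℂ) (v : ι → ℂ), v ≠ 0 → toComplex M *ᵥ v = μ • v → μ.re < 0 := by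
  have h : Hurwitz M ↔ ∀ μ ∈ spectrum ℂ (toComplex M), μ.re < 0 := Iff.rfl
  simp only [h, mem_spectrum_iff_mulVec]
  exact ⟨fun h μ v hv he => h μ ⟨v, hv, he⟩, fun h μ ⟨v, hv, he⟩ => h μ v hv he⟩

theorem hurwitz_iff_vecMul {ι : Type} [Fintype ι] [DecidableEq ι] {M : Matrix ι ι ℝ} :
    Hurwitz M ↔ ∀ (μ : ℂ) (v : ι → ℂ), v ≠ 0 → v ᵥ* toComplex M = μ • v → μ.re < 0 := by
  have h : Hurwitz M ↔ ∀ μ ∈ spectrum ℂ (toComplex M), μ.re < 0 := Iff.rfl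
  simp only [h, mem_spectrum_iff_vecMul]
  exact ⟨fun h μ v hv he => h μ ⟨v, hv, he⟩, fun h μ ⟨v, hv, he⟩ => h μ v hv he⟩

theorem dotProduct_self_nonneg {ι : Type*} [Fintype ι] (x : ι → ℝ) : 0 ≤ x ⬝ᵥ x := by
  simpa using dotProduct_star_self_nonneg x

theorem dotProduct_self_pos {ι : Type*} [Fintype ι] {x : ι → ℝ} (hx : x ≠ 0) : 0 < x ⬝ᵥ x :=
  lt_of_le_of_ne (dotProduct_self_nonneg x) fun h => hx (dotProduct_self_eq_zero.1 h.symm)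

open scoped Matrix.Norms.L2Operator in
-- Gelfand's formula: the powers are eventually dominated by `q ^ k`, for any `q` strictly between
-- the spectral radius and 1.
theorem tendsto_norm_pow_of_spectrum {ι : Type*} [Fintype ι] [DecidableEq ι] [Nonempty ι]
    {M : Matrix ι ι ℂ} (hM : ∀ μ ∈ spectrum ℂ M, ‖μ‖ < 1) :
    Tendsto (fun k => ‖M ^ k‖) atTop (𝓝 0) := by
  have hr : spectralRadius ℂ M < ((1 : NNReal) : ENNReal) :=
    spectrum.spectralRadius_lt_of_forall_lt M fun z hz => hM z hz
  obtain ⟨q, hq1, hq2⟩ := ENNReal.lt_iff_exists_nnreal_btwn.1 hr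
  have hq : q < 1 := by exact_mod_cast hq2
  have hev : ∀ᶠ k : ℕ in atTop, ‖M ^ k‖ ≤ (q : ℝ) ^ k := by
    filter_upwards [(spectrum.pow_nnnorm_pow_one_div_tendsto_nhds_spectralRadius M).eventually_lt_const
      hq1, eventually_gt_atTop 0] with k hk hk0
    have hk0' : (0 : ℝ) < k := by exact_mod_cast hk0
    have h1 := ENNReal.rpow_le_rpow hk.le hk0'.le
    rw [← ENNReal.rpow_mul, one_div, inv_mul_cancel₀ hk0'.ne', ENNReal.rpow_one,
      ENNReal.rpow_natCast] at h1
    exact_mod_cast h1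
  exact squeeze_zero' (Eventually.of_forall fun k => norm_nonneg _) hev
    (tendsto_pow_atTop_nhds_zero_of_lt_one q.2 (by exact_mod_cast hq))

open scoped Matrix.Norms.L2Operator in
theorem exists_pow_contraction {ι : Type*} [Fintype ι] [DecidableEq ι] {M : Matrix ι ι ℝ}
    (hM : ∀ μ ∈ spectrum ℂ (toComplex M), ‖μ‖ < 1) :
    ∃ k : ℕ, ∀ x : ι → ℝ, ((M ^ k) *ᵥ x) ⬝ᵥ ((M ^ k) *ᵥ x) ≤ 1 / 2 * (x ⬝ᵥ x) := by
  rcases isEmpty_or_nonempty ι with hι | hι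
  · exact ⟨0, fun x => by simp [dotProduct]⟩
  obtain ⟨k, hk⟩ := ((tendsto_norm_pow_of_spectrum hM).eventually_le_const
    (show (0 : ℝ) < 1 / 2 by norm_num)).exists
  refine ⟨k, fun x => ?_⟩
  have h1 := Matrix.l2_opNorm_mulVec (toComplex (M ^ k))
    (WithLp.toLp 2 (fun i => (x i : ℂ)) : EuclideanSpace ℂ ι)
  have hn : ∀ y : ι → ℝ, ‖(WithLp.toLp 2 (fun i => (y i : ℂ)) : EuclideanSpace ℂ ι)‖ ^ 2 = y ⬝ᵥ y := by
    intro y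
    rw [EuclideanSpace.norm_sq_eq]
    simp [dotProduct, sq]
  have h2 : ‖(WithLp.toLp 2 (fun i => (((M ^ k) *ᵥ x) i : ℂ)) : EuclideanSpace ℂ ι)‖
      ≤ 1 / 2 * ‖(WithLp.toLp 2 (fun i => (x i : ℂ)) : EuclideanSpace ℂ ι)‖ := by
    rw [← toComplex_mulVec]
    refine h1.trans (mul_le_mul_of_nonneg_right ?_ (norm_nonneg _))
    rwa [toComplex_pow]
  have h3 := pow_le_pow_left₀ (norm_nonneg _) h2 2
  rw [mul_pow, hn, hn] at h3
  have := dotProduct_self_nonneg x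
  linarith

/-- A truncated sum `∑ (M ^ j)ᵀ M ^ j` suffices: one step of `M` telescopes it, and the boundary
term `‖M ^ k x‖²` is at most half of `‖x‖²`. No infinite series is involved. -/
theorem exists_discrete_lyapunov {ι : Type*} [Fintype ι] [DecidableEq ι] {M : Matrix ι ι ℝ}
    (hM : ∀ μ ∈ spectrum ℂ (toComplex M), ‖μ‖ < 1) :
    ∃ Y : Matrix ι ι ℝ, Y.PosDef ∧ ∀ x : ι → ℝ,
      (M *ᵥ x) ⬝ᵥ Y *ᵥ (M *ᵥ x) ≤ x ⬝ᵥ Y *ᵥ x - 1 / 2 * (x ⬝ᵥ x) := by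
  obtain ⟨k, hk⟩ := exists_pow_contraction hM
  have hk' : ∀ x : ι → ℝ, ((M ^ (k + 1)) *ᵥ x) ⬝ᵥ ((M ^ (k + 1)) *ᵥ x) ≤
      1 / 2 * ((M *ᵥ x) ⬝ᵥ (M *ᵥ x)) := fun x => by
    rw [pow_succ, ← Matrix.mulVec_mulVec]; exact hk _
  set Y : Matrix ι ι ℝ := ∑ j ∈ Finset.range k, (M ^ j)ᵀ * M ^ j with hYdef
  have hform : ∀ x, x ⬝ᵥ Y *ᵥ x = ∑ j ∈ Finset.range k, ((M ^ j) *ᵥ x) ⬝ᵥ ((M ^ j) *ᵥ x) := by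
    intro x
    rw [hYdef, Matrix.sum_mulVec, dotProduct_sum]
    exact Finset.sum_congr rfl fun j _ => quadForm_transpose_mul_self _ _
  have hsym : Yᵀ = Y := by
    simp [hYdef, Matrix.transpose_sum, Matrix.transpose_mul]
  have hstep : ∀ x, (M *ᵥ x) ⬝ᵥ Y *ᵥ (M *ᵥ x)
      = x ⬝ᵥ Y *ᵥ x - x ⬝ᵥ x + ((M ^ k) *ᵥ x) ⬝ᵥ ((M ^ k) *ᵥ x) := by
    intro x
    have h1 := Finset.sum_range_succ (fun j => ((M ^ j) *ᵥ x) ⬝ᵥ ((M ^ j) *ᵥ x)) k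
    have h2 := Finset.sum_range_succ' (fun j => ((M ^ j) *ᵥ x) ⬝ᵥ ((M ^ j) *ᵥ x)) k
    rw [hform, hform]
    simp only [Matrix.mulVec_mulVec, ← pow_succ]
    rw [h1] at h2
    simp only [pow_zero, Matrix.one_mulVec] at h2
    linarith
  refine ⟨Y, posDef_iff_quadForm.2 ⟨hsym, fun x hx => ?_⟩, fun x => ?_⟩
  · have h1 := hstep x
    have h2 : 0 ≤ (M *ᵥ x) ⬝ᵥ Y *ᵥ (M *ᵥ x) := by
      rw [hform]
      exact Finset.sum_nonneg fun j _ => dotProduct_self_nonneg _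
    have h3 := hk x
    have h4 := dotProduct_self_pos hx
    linarith
  · have := hk x
    rw [hstep]
    linarith

/-- Since `‖1 + δμ‖² = 1 + 2δ Re μ + δ² ‖μ‖²`, a small Euler step moves a stable eigenvalue into the
unit disc; finiteness of the spectrum gives a common `δ`. -/
theorem exists_step_of_hurwitz {ι : Type} [Fintype ι] [DecidableEq ι] {A : Matrix ι ι ℝ}
    (hA : Hurwitz A) : ∃ δ : ℝ, 0 < δ ∧
      ∀ μ ∈ spectrum ℂ (toComplex (1 + δ • A)), ‖μ‖ < 1 := by
  have hμ : ∀ μ ∈ spectrum ℂ (toComplex A), ∀ᶠ δ : ℝ in 𝓝[>] 0, ‖1 + (δ : ℂ) * μ‖ < 1 := by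
    intro μ hμ
    have hre : μ.re < 0 := hA μ hμ
    have hpos : 0 < -μ.re / (Complex.normSq μ + 1) :=
      div_pos (by linarith) (by have := Complex.normSq_nonneg μ; linarith)
    filter_upwards [Ioo_mem_nhdsGT hpos] with δ hδ
    rw [← sq_lt_one_iff₀ (norm_nonneg _), ← Complex.normSq_eq_norm_sq, Complex.normSq_apply]
    have h1 : δ * (Complex.normSq μ + 1) < -μ.re :=
      (lt_div_iff₀ (by have := Complex.normSq_nonneg μ; linarith)).1 hδ.2
    rw [Complex.normSq_apply] at h1
    simp only [Complex.add_re, Complex.one_re, Complex.re_ofReal_mul, Complex.add_im,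
      Complex.one_im, Complex.im_ofReal_mul]
    have h2 := mul_lt_mul_of_pos_left h1 hδ.1
    nlinarith [mul_pos hδ.1 hδ.1, hδ.1]
  obtain ⟨δ, hδ, hδ0⟩ := (((eventually_all_finite (toComplex A).finite_spectrum).2 hμ).and
    self_mem_nhdsWithin).exists
  have hδ0 : (0 : ℝ) < δ := hδ0
  refine ⟨δ, hδ0, fun μ h => ?_⟩
  obtain ⟨v, hv, he⟩ := mem_spectrum_iff_mulVec.1 h
  have hδc : (δ : ℂ) ≠ 0 := by exact_mod_cast hδ0.ne'
  have h1 : (δ : ℂ)⁻¹ * (μ - 1) ∈ spectrum ℂ (toComplex A) := by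
    refine mem_spectrum_iff_mulVec.2 ⟨v, hv, ?_⟩
    rw [toComplex_add, toComplex_one, toComplex_smul, Matrix.add_mulVec, Matrix.one_mulVec,
      Matrix.smul_mulVec] at he
    rw [mul_smul, sub_smul, one_smul, ← he, add_sub_cancel_left, inv_smul_smul₀ hδc]
  have h2 := hδ _ h1
  rwa [mul_inv_cancel_left₀ hδc, add_sub_cancel] at h2

/-- A Hurwitz matrix has a strict quadratic Lyapunov function. -/
theorem exists_lyapunov {ι : Type} [Fintype ι] [DecidableEq ι] {A : Matrix ι ι ℝ}
    (hA : Hurwitz A) : ∃ Y : Matrix ι ι ℝ, Y.PosDef ∧ ∃ c : ℝ, 0 < c ∧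
      ∀ x : ι → ℝ, 2 * (x ⬝ᵥ Y *ᵥ (A *ᵥ x)) ≤ -c * (x ⬝ᵥ x) := by
  obtain ⟨δ, hδ, hsp⟩ := exists_step_of_hurwitz hA
  obtain ⟨Y, hY, h⟩ := exists_discrete_lyapunov hsp
  refine ⟨Y, hY, 1 / (2 * δ), by positivity, fun x => ?_⟩
  obtain ⟨hYs, -⟩ := posDef_iff_quadForm.1 hY
  have h1 := h x
  -- Expanding the discrete inequality for `1 + δA` produces the wanted derivative term and the
  -- second order term `δ² (Ax)ᵀ Y (Ax)`, whose nonnegative sign allows dropping it.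
  have h2 := (posSemidef_iff_quadForm.1 hY.posSemidef).2 (A *ᵥ x)
  rw [Matrix.add_mulVec, Matrix.one_mulVec, Matrix.smul_mulVec, Matrix.mulVec_add, dotProduct_add,
    add_dotProduct, add_dotProduct, Matrix.mulVec_smul, dotProduct_smul, smul_dotProduct,
    smul_dotProduct, dotProduct_smul, dotProduct_mulVec_swap hYs (A *ᵥ x) x] at h1
  simp only [smul_eq_mul] at h1
  have h3 : 0 ≤ δ * (δ * ((A *ᵥ x) ⬝ᵥ Y *ᵥ (A *ᵥ x))) := by positivity
  have h4 : δ * (2 * (x ⬝ᵥ Y *ᵥ (A *ᵥ x))) ≤ δ * (-(1 / (2 * δ)) * (x ⬝ᵥ x)) := by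
    have : δ * (-(1 / (2 * δ)) * (x ⬝ᵥ x)) = -(1 / 2) * (x ⬝ᵥ x) := by
      field_simp
    rw [this]
    linarith
  exact le_of_mul_le_mul_left h4 hδ

end FaultEst
end

noncomputable section

namespace FaultEst

open Filter Topology

/-! ### Dissipation inequalities: algebra -/

theorem mulVec_eq_zero_of_quadForm {ι : Type*} [Fintype ι] {P : Matrix ι ι ℝ} (hP : P.PosSemidef)
    {x : ι → ℝ} (hx : x ⬝ᵥ P *ᵥ x = 0) : P *ᵥ x = 0 :=
  (hP.dotProduct_mulVec_zero_iff x).1 (by simpa using hx)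

theorem mulVec_dotProduct {ι σ : Type*} [Fintype ι] [Fintype σ] (U : Matrix σ ι ℝ) (x : ι → ℝ)
    (y : σ → ℝ) : (U *ᵥ x) ⬝ᵥ y = x ⬝ᵥ Uᵀ *ᵥ y := by
  rw [dotProduct_comm, Matrix.mulVec_transpose, Matrix.dotProduct_mulVec, dotProduct_comm]

theorem exists_quadForm_le {ι : Type*} [Fintype ι] (M : Matrix ι ι ℝ) :
    ∃ c : ℝ, 0 ≤ c ∧ ∀ x : ι → ℝ, x ⬝ᵥ M *ᵥ x ≤ c * (x ⬝ᵥ x) := by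
  refine ⟨∑ i, ∑ j, |M i j|, Finset.sum_nonneg fun i _ => Finset.sum_nonneg fun j _ => abs_nonneg _,
    fun x => ?_⟩
  have hle : ∀ i, x i * x i ≤ x ⬝ᵥ x := fun i =>
    Finset.single_le_sum (f := fun i => x i * x i) (fun j _ => mul_self_nonneg _) (Finset.mem_univ i)
  simp only [dotProduct, Matrix.mulVec, Finset.mul_sum]
  simp only [← Finset.mul_sum]
  rw [Finset.sum_mul]
  refine Finset.sum_le_sum fun i _ => ?_
  rw [Finset.sum_mul, Finset.mul_sum]
  refine Finset.sum_le_sum fun j _ => ?_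
  have h1 : |x i * x j| ≤ x ⬝ᵥ x := by
    have := hle i
    have := hle j
    exact abs_le.2 ⟨by nlinarith [sq_nonneg (x i + x j)], by nlinarith [sq_nonneg (x i - x j)]⟩
  calc x i * (M i j * x j) = M i j * (x i * x j) := by ring
    _ ≤ |M i j * (x i * x j)| := le_abs_self _
    _ = |M i j| * |x i * x j| := abs_mul _ _
    _ ≤ |M i j| * (x ⬝ᵥ x) := mul_le_mul_of_nonneg_left h1 (abs_nonneg _)

theorem exists_mulVec_dotProduct_le {ι σ : Type*} [Fintype ι] [Fintype σ] (U W : Matrix σ ι ℝ) :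
    ∃ c : ℝ, 0 ≤ c ∧ ∀ x : ι → ℝ, (U *ᵥ x) ⬝ᵥ (W *ᵥ x) ≤ c * (x ⬝ᵥ x) := by
  obtain ⟨c, hc, h⟩ := exists_quadForm_le (Uᵀ * W)
  refine ⟨c, hc, fun x => ?_⟩
  rw [mulVec_dotProduct, Matrix.mulVec_mulVec]
  exact h x

theorem isCompact_unitSphere {ι : Type*} [Fintype ι] : IsCompact {x : ι → ℝ | x ⬝ᵥ x = 1} := by
  refine (isCompact_univ_pi fun _ : ι => isCompact_Icc (a := (-1 : ℝ)) (b := 1)).of_isClosed_subset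
    (isClosed_eq (by fun_prop) continuous_const) fun x hx i _ => ?_
  have h1 : x i * x i ≤ x ⬝ᵥ x :=
    Finset.single_le_sum (f := fun i => x i * x i) (fun j _ => mul_self_nonneg _) (Finset.mem_univ i)
  rw [Set.mem_ofPred_eq] at hx
  exact abs_le.1 (by rw [← sq_le_one_iff_abs_le_one]; nlinarith)

/-- A symmetric matrix that decreases along a stable linear system is positive semidefinite. -/
theorem posSemidef_of_hurwitz {ι : Type} [Fintype ι] [DecidableEq ι] {A P : Matrix ι ι ℝ}
    (hA : Hurwitz A) (hP : Pᵀ = P) (h : ∀ x : ι → ℝ, x ⬝ᵥ P *ᵥ (A *ᵥ x) ≤ 0) : P.PosSemidef := by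
  obtain ⟨Y, hY, c, hc, hYA⟩ := exists_lyapunov hA
  obtain ⟨hYs, hYp⟩ := posDef_iff_quadForm.1 hY
  refine posSemidef_iff_quadForm.2 ⟨hP, ?_⟩
  by_contra! hneg
  obtain ⟨z, hz⟩ := hneg
  have hnorm : ∀ x : ι → ℝ, x ≠ 0 → ((√(x ⬝ᵥ x))⁻¹ • x) ⬝ᵥ ((√(x ⬝ᵥ x))⁻¹ • x) = 1 := by
    intro x hx
    have hx0 := dotProduct_self_pos hx
    rw [smul_dotProduct, dotProduct_smul, smul_eq_mul, smul_eq_mul, ← mul_assoc, ← mul_inv,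
      Real.mul_self_sqrt hx0.le, inv_mul_cancel₀ hx0.ne']
  have hz0 : z ≠ 0 := by
    rintro rfl
    simp at hz
  obtain ⟨x₀, hx₀, hmin⟩ := (isCompact_unitSphere (ι := ι)).exists_isMinOn ⟨_, hnorm z hz0⟩
    (f := fun x => x ⬝ᵥ P *ᵥ x / x ⬝ᵥ Y *ᵥ x) (by
      refine ContinuousOn.div (by fun_prop) (by fun_prop) fun x hx => (hYp x ?_).ne'
      rintro rfl
      simp at hx)
  have hx₀0 : x₀ ≠ 0 := by
    rintro rfl
    simp at hx₀
  -- If `P` has a negative direction, the minimum `m` of the quotient of the forms `P` and `Y` is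
  -- negative. Then `P - m Y` is semidefinite with `x₀` in its kernel, so pairing it with `A x₀`
  -- gives zero. The term from `P` is at most 0 and that from `-m Y` is strictly negative: a
  -- contradiction.
  set m := x₀ ⬝ᵥ P *ᵥ x₀ / x₀ ⬝ᵥ Y *ᵥ x₀ with hm
  have hbound : ∀ x : ι → ℝ, 0 ≤ x ⬝ᵥ (P - m • Y) *ᵥ x := by
    intro x
    by_cases hx : x = 0
    · simp [hx]
    have h1 : m ≤ _ := hmin (hnorm x hx)
    have hs : (√(x ⬝ᵥ x))⁻¹ ≠ 0 :=
      inv_ne_zero (Real.sqrt_pos.2 (dotProduct_self_pos hx)).ne'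
    simp only [smul_dotProduct, Matrix.mulVec_smul, dotProduct_smul, smul_eq_mul] at h1
    rw [mul_div_mul_left _ _ hs, mul_div_mul_left _ _ hs, le_div_iff₀ (hYp x hx)] at h1
    rw [Matrix.sub_mulVec, dotProduct_sub, Matrix.smul_mulVec, dotProduct_smul, smul_eq_mul]
    linarith
  have hmz : m < 0 := by
    have h1 := hbound z
    rw [Matrix.sub_mulVec, dotProduct_sub, Matrix.smul_mulVec, dotProduct_smul, smul_eq_mul] at h1
    have h2 := hYp z hz0
    by_contra! h3
    have := mul_nonneg h3 h2.le
    linarith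
  have hWs : (P - m • Y)ᵀ = P - m • Y := by
    rw [Matrix.transpose_sub, Matrix.transpose_smul, hP, hYs]
  have hW0 : (P - m • Y) *ᵥ x₀ = 0 := by
    refine mulVec_eq_zero_of_quadForm (posSemidef_iff_quadForm.2 ⟨hWs, hbound⟩) ?_
    rw [Matrix.sub_mulVec, dotProduct_sub, Matrix.smul_mulVec, dotProduct_smul, smul_eq_mul, hm,
      div_mul_cancel₀ _ (hYp x₀ hx₀0).ne', sub_self]
  have h4 : x₀ ⬝ᵥ (P - m • Y) *ᵥ (A *ᵥ x₀) = 0 := by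
    rw [dotProduct_mulVec_swap hWs, hW0, dotProduct_zero]
  rw [Matrix.sub_mulVec, dotProduct_sub, Matrix.smul_mulVec, dotProduct_smul, smul_eq_mul] at h4
  have h5 := h x₀
  have h6 := hYA x₀
  have h7 := dotProduct_self_pos hx₀0
  nlinarith [mul_pos hc h7]

/-! ### The Riccati form of dissipativity -/

section Riccati

variable {ι κ σ : Type} [Fintype ι] [Fintype κ] [Fintype σ]
  {A : Matrix ι ι ℝ} {B : Matrix ι κ ℝ} {C : Matrix σ ι ℝ} {ρ : ℝ} {P : Matrix ι ι ℝ}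

/-- Completing the square in `w`: the worst disturbance is `ρ⁻¹ Bᵀ P x`, and eliminating it leaves
the Riccati inequality. -/
theorem isDissipative_iff_riccati (hP : Pᵀ = P) (hρ : 0 < ρ) :
    IsDissipative A B C ρ P ↔ ∀ x : ι → ℝ, 2 * (x ⬝ᵥ P *ᵥ (A *ᵥ x)) + (C *ᵥ x) ⬝ᵥ (C *ᵥ x)
      + ρ⁻¹ * ((Bᵀ *ᵥ (P *ᵥ x)) ⬝ᵥ (Bᵀ *ᵥ (P *ᵥ x))) ≤ 0 := by
  have hB : ∀ (x : ι → ℝ) (w : κ → ℝ), x ⬝ᵥ P *ᵥ (B *ᵥ w) = (Bᵀ *ᵥ (P *ᵥ x)) ⬝ᵥ w := fun x w => by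
    rw [dotProduct_mulVec_swap hP, mulVec_dotProduct, dotProduct_comm]
  unfold IsDissipative
  simp only [Matrix.mulVec_add, dotProduct_add, hB]
  refine forall_congr' fun x => ⟨fun h => ?_, fun h w => ?_⟩
  · have h1 := h (ρ⁻¹ • (Bᵀ *ᵥ (P *ᵥ x)))
    simp only [dotProduct_smul, smul_dotProduct, smul_eq_mul] at h1
    rw [mul_inv_cancel_left₀ hρ.ne'] at h1
    linarith
  · have h1 := dotProduct_self_nonneg (w - ρ⁻¹ • (Bᵀ *ᵥ (P *ᵥ x)))
    simp only [sub_dotProduct, dotProduct_sub, dotProduct_smul, smul_dotProduct, smul_eq_mul] at h1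
    rw [dotProduct_comm w (Bᵀ *ᵥ (P *ᵥ x))] at h1
    have h2 := mul_nonneg hρ.le h1
    have h3 : ρ * ρ⁻¹ = 1 := mul_inv_cancel₀ hρ.ne'
    have h4 : ρ * (w ⬝ᵥ w - ρ⁻¹ * (Bᵀ *ᵥ (P *ᵥ x)) ⬝ᵥ w - ρ⁻¹ * ((Bᵀ *ᵥ (P *ᵥ x)) ⬝ᵥ w
        - ρ⁻¹ * (Bᵀ *ᵥ (P *ᵥ x)) ⬝ᵥ (Bᵀ *ᵥ (P *ᵥ x))))
        = ρ * (w ⬝ᵥ w) - 2 * (Bᵀ *ᵥ (P *ᵥ x)) ⬝ᵥ w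
          + ρ⁻¹ * (Bᵀ *ᵥ (P *ᵥ x)) ⬝ᵥ (Bᵀ *ᵥ (P *ᵥ x)) := by
      linear_combination (-2 * (Bᵀ *ᵥ (P *ᵥ x)) ⬝ᵥ w
        + ρ⁻¹ * (Bᵀ *ᵥ (P *ᵥ x)) ⬝ᵥ (Bᵀ *ᵥ (P *ᵥ x))) * h3
    rw [h4] at h2
    linarith

variable (A B ρ P) in
/-- The closed loop matrix for the worst-case disturbance `w = ρ⁻¹ Bᵀ P x`. -/
def closedLoop : Matrix ι ι ℝ := A + ρ⁻¹ • (B * Bᵀ * P)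

theorem closedLoop_mulVec (x : ι → ℝ) :
    closedLoop A B ρ P *ᵥ x = A *ᵥ x + ρ⁻¹ • (B *ᵥ (Bᵀ *ᵥ (P *ᵥ x))) := by
  rw [closedLoop, Matrix.add_mulVec, Matrix.smul_mulVec, Matrix.mul_assoc, ← Matrix.mulVec_mulVec,
    ← Matrix.mulVec_mulVec]

/-- Change of the Riccati form under a symmetric perturbation of `P`. -/
theorem riccati_add {D : Matrix ι ι ℝ} (hD : Dᵀ = D) (x : ι → ℝ) :
    2 * (x ⬝ᵥ (P + D) *ᵥ (A *ᵥ x)) + (C *ᵥ x) ⬝ᵥ (C *ᵥ x)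
      + ρ⁻¹ * ((Bᵀ *ᵥ ((P + D) *ᵥ x)) ⬝ᵥ (Bᵀ *ᵥ ((P + D) *ᵥ x)))
    = 2 * (x ⬝ᵥ P *ᵥ (A *ᵥ x)) + (C *ᵥ x) ⬝ᵥ (C *ᵥ x)
      + ρ⁻¹ * ((Bᵀ *ᵥ (P *ᵥ x)) ⬝ᵥ (Bᵀ *ᵥ (P *ᵥ x)))
      + (2 * (x ⬝ᵥ D *ᵥ (closedLoop A B ρ P *ᵥ x))
        + ρ⁻¹ * ((Bᵀ *ᵥ (D *ᵥ x)) ⬝ᵥ (Bᵀ *ᵥ (D *ᵥ x)))) := by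
  have h1 : x ⬝ᵥ D *ᵥ (B *ᵥ (Bᵀ *ᵥ (P *ᵥ x))) = (Bᵀ *ᵥ (D *ᵥ x)) ⬝ᵥ (Bᵀ *ᵥ (P *ᵥ x)) := by
    rw [dotProduct_mulVec_swap hD, mulVec_dotProduct, dotProduct_comm]
  rw [closedLoop_mulVec]
  simp only [Matrix.add_mulVec, Matrix.mulVec_add, Matrix.mulVec_smul, dotProduct_add,
    add_dotProduct, dotProduct_smul, smul_eq_mul, h1]
  rw [dotProduct_comm (Bᵀ *ᵥ (P *ᵥ x)) (Bᵀ *ᵥ (D *ᵥ x))]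
  ring

/-- The kernel of a positive semidefinite solution is invariant. -/
theorem mulVec_mulVec_eq_zero_of_isDissipative (hP : P.PosSemidef) (hd : IsDissipative A B C ρ P)
    {v : ι → ℝ} (hv : P *ᵥ v = 0) : P *ᵥ (A *ᵥ v) = 0 := by
  obtain ⟨hPs, -⟩ := posSemidef_iff_quadForm.1 hP
  have hCv : C *ᵥ v = 0 := by
    have h1 := hd v 0
    rw [dotProduct_mulVec_swap hPs, hv] at h1
    simp only [dotProduct_zero, mul_zero, zero_add, sub_zero] at h1
    exact dotProduct_self_eq_zero.1 (le_antisymm h1 (dotProduct_self_nonneg _))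
  refine dotProduct_eq_zero _ fun y => ?_
  set a := y ⬝ᵥ P *ᵥ (A *ᵥ v) with ha
  set b := y ⬝ᵥ P *ᵥ (A *ᵥ y) with hb
  -- At `v + t y` with zero disturbance the quadratic part in `v` vanishes, leaving `2 t a + t² d ≤
  -- 0` for all real `t`, which forces `a = 0`; below, `t = a / (|d| + 1)` is used.
  have key : ∀ t : ℝ, 2 * (t * a + t * (t * b)) + t * (t * (C *ᵥ y) ⬝ᵥ (C *ᵥ y)) ≤ 0 := by
    intro t
    have h1 := hd (v + t • y) 0
    simp only [Matrix.mulVec_add, Matrix.mulVec_smul, Matrix.mulVec_zero, add_zero, hCv, zero_add,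
      dotProduct_zero, mul_zero, sub_zero, add_dotProduct, smul_dotProduct, dotProduct_smul,
      dotProduct_add, smul_eq_mul] at h1
    rw [dotProduct_mulVec_swap hPs v, dotProduct_mulVec_swap hPs v, hv, dotProduct_zero,
      dotProduct_zero] at h1
    rw [ha, hb]
    linarith
  rw [dotProduct_comm, ← ha]
  by_contra hne
  set d := 2 * b + (C *ᵥ y) ⬝ᵥ (C *ᵥ y) with hd'
  have h2 := key (a / (|d| + 1))
  have hpos : 0 < |d| + 1 := by positivity
  have h3 : 2 * (a / (|d| + 1) * a + a / (|d| + 1) * (a / (|d| + 1) * b))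
      + a / (|d| + 1) * (a / (|d| + 1) * (C *ᵥ y) ⬝ᵥ (C *ᵥ y))
      = a ^ 2 * (2 * (|d| + 1) + d) / (|d| + 1) ^ 2 := by
    rw [hd']
    field_simp
    ring
  rw [h3] at h2
  have h4 : 0 < a ^ 2 * (2 * (|d| + 1) + d) / (|d| + 1) ^ 2 := by
    have : 0 < 2 * (|d| + 1) + d := by linarith [neg_abs_le d, abs_nonneg d]
    positivity
  linarith

/-- Among the positive semidefinite solutions there is one of least trace. -/
theorem exists_trace_minimal (h : ∃ P : Matrix ι ι ℝ, P.PosSemidef ∧ IsDissipative A B C ρ P) :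
    ∃ P : Matrix ι ι ℝ, P.PosSemidef ∧ IsDissipative A B C ρ P ∧
      ∀ P' : Matrix ι ι ℝ, P'.PosSemidef → IsDissipative A B C ρ P' → P.trace ≤ P'.trace := by
  classical
  obtain ⟨P₀, hP₀, hd₀⟩ := h
  set s : Set (Matrix ι ι ℝ) :=
    {P | (P.PosSemidef ∧ IsDissipative A B C ρ P) ∧ P.trace ≤ P₀.trace} with hs
  have hclosed : IsClosed s := by
    have h1 : IsClosed {P : Matrix ι ι ℝ | P.PosSemidef} := by
      simp only [posSemidef_iff_quadForm, Set.ofPred_and, Set.ofPred_forall]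
      exact (isClosed_eq (by fun_prop) (by fun_prop)).inter
        (isClosed_iInter fun x => isClosed_le (by fun_prop) (by fun_prop))
    have h2 : IsClosed {P : Matrix ι ι ℝ | IsDissipative A B C ρ P} := by
      simp only [IsDissipative, Set.ofPred_forall]
      exact isClosed_iInter fun x => isClosed_iInter fun w =>
        isClosed_le (by fun_prop) (by fun_prop)
    have h3 : Continuous fun P : Matrix ι ι ℝ => P.trace := by fun_prop
    exact (h1.inter h2).inter (isClosed_le h3 continuous_const)
  -- A bound on the trace bounds every entry: diagonal entries are nonnegative, and testing with
  -- `e_i ± e_j` controls the off-diagonal ones. So the candidate set is compact.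
  have hsub : s ⊆ Set.univ.pi fun _ : ι => Set.univ.pi fun _ : ι =>
      Set.Icc (-P₀.trace) P₀.trace := by
    rintro P ⟨⟨hP, -⟩, htr⟩ i - j -
    obtain ⟨hPs, hPn⟩ := posSemidef_iff_quadForm.1 hP
    have hdiag : ∀ k, 0 ≤ P k k := fun k => hP.diag_nonneg
    have hle : ∀ k, P k k ≤ P₀.trace := fun k =>
      (Finset.single_le_sum (f := fun k => P k k) (fun j _ => hdiag j) (Finset.mem_univ k)).trans htr
    have hji : P j i = P i j := congrFun (congrFun hPs i) j
    have h1 := hPn (Pi.single i 1 + Pi.single j 1)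
    have h2 := hPn (Pi.single i 1 - Pi.single j 1)
    simp only [Matrix.mulVec_add, Matrix.mulVec_sub, add_dotProduct, sub_dotProduct, dotProduct_add,
      dotProduct_sub, Matrix.mulVec_single_one, single_one_dotProduct, Matrix.col_apply] at h1 h2
    have := hle i
    have := hle j
    exact ⟨by linarith, by linarith⟩
  have hcomp : IsCompact s := (isCompact_univ_pi fun _ => isCompact_univ_pi fun _ =>
    isCompact_Icc).of_isClosed_subset hclosed hsub
  obtain ⟨P, hPs, hmin⟩ := hcomp.exists_isMinOn ⟨P₀, ⟨hP₀, hd₀⟩, le_rfl⟩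
    (f := fun P => P.trace) (Continuous.continuousOn (by fun_prop))
  refine ⟨P, hPs.1.1, hPs.1.2, fun P' hP' hd' => ?_⟩
  by_cases h : P'.trace ≤ P₀.trace
  · exact hmin ⟨⟨hP', hd'⟩, h⟩
  · exact hPs.2.trans (not_le.1 h).le

end Riccati

end FaultEst
end

noncomputable section

namespace FaultEst

open Filter Topology Polynomial

/-! ### Polynomials in a real matrix and complex eigenvectors -/

section Aeval

variable {ι : Type} [Fintype ι] [DecidableEq ι]

theorem toComplex_aeval_mulVec {M : Matrix ι ι ℝ} {μ : ℂ} {v : ι → ℂ}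
    (hv : toComplex M *ᵥ v = μ • v) (q : ℝ[X]) :
    toComplex (aeval M q) *ᵥ v = (aeval μ q) • v := by
  induction q using Polynomial.induction_on' with
  | add p q hp hq => rw [map_add, map_add, toComplex_add, Matrix.add_mulVec, hp, hq, add_smul]
  | monomial k c =>
    have hk : ∀ k : ℕ, toComplex M ^ k *ᵥ v = μ ^ k • v := by
      intro k
      induction k with
      | zero => simp
      | succ k ih => rw [pow_succ', ← Matrix.mulVec_mulVec, ih, Matrix.mulVec_smul, hv, smul_smul,
          pow_succ]
    rw [aeval_monomial, aeval_monomial, ← Algebra.smul_def, ← Algebra.smul_def, toComplex_smul,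
      toComplex_pow, Matrix.smul_mulVec, hk, smul_assoc]
    rfl

theorem vecMul_toComplex_aeval {M : Matrix ι ι ℝ} {μ : ℂ} {v : ι → ℂ}
    (hv : v ᵥ* toComplex M = μ • v) (q : ℝ[X]) :
    v ᵥ* toComplex (aeval M q) = (aeval μ q) • v := by
  induction q using Polynomial.induction_on' with
  | add p q hp hq => rw [map_add, map_add, toComplex_add, Matrix.vecMul_add, hp, hq, add_smul]
  | monomial k c =>
    have hk : ∀ k : ℕ, v ᵥ* toComplex M ^ k = μ ^ k • v := by
      intro k
      induction k with
      | zero => simp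
      | succ k ih => rw [pow_succ, ← Matrix.vecMul_vecMul, ih, Matrix.smul_vecMul, hv, smul_smul,
          pow_succ]
    rw [aeval_monomial, aeval_monomial, ← Algebra.smul_def, ← Algebra.smul_def, toComplex_smul,
      toComplex_pow, Matrix.vecMul_smul, hk, smul_assoc]
    rfl

theorem aeval_charpoly_eq_zero_iff {M : Matrix ι ι ℝ} {μ : ℂ} :
    aeval μ M.charpoly = 0 ↔ μ ∈ spectrum ℂ (toComplex M) := by
  have h : (toComplex M).charpoly = M.charpoly.map (algebraMap ℝ ℂ) :=
    Matrix.charpoly_map M (algebraMap ℝ ℂ)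
  rw [Matrix.mem_spectrum_iff_isRoot_charpoly, h, IsRoot.def, eval_map_algebraMap]

/-- On the kernel of `P` the feedback term vanishes and `A` preserves this kernel, so the closed
loop acts there as `A`. With `q` the characteristic polynomial of `A`, Cayley–Hamilton then applies
to the closed loop on the kernel. -/
theorem aeval_closedLoop_mulVec {κ σ : Type} [Fintype κ] [Fintype σ] {A P : Matrix ι ι ℝ}
    {B : Matrix ι κ ℝ} {C : Matrix σ ι ℝ} {ρ : ℝ} (hP : P.PosSemidef)
    (hd : IsDissipative A B C ρ P) {v : ι → ℝ} (hv : P *ᵥ v = 0) (q : ℝ[X]) :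
    aeval (closedLoop A B ρ P) q *ᵥ v = aeval A q *ᵥ v := by
  induction q using Polynomial.induction_on' with
  | add p q hp hq => rw [map_add, map_add, Matrix.add_mulVec, Matrix.add_mulVec, hp, hq]
  | monomial k c =>
    have hk : ∀ k : ℕ, closedLoop A B ρ P ^ k *ᵥ v = A ^ k *ᵥ v ∧ P *ᵥ (A ^ k *ᵥ v) = 0 := by
      intro k
      induction k with
      | zero => simp [hv]
      | succ k ih =>
        rw [pow_succ', pow_succ', ← Matrix.mulVec_mulVec, ← Matrix.mulVec_mulVec, ih.1,
          closedLoop_mulVec, ih.2]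
        exact ⟨by simp, mulVec_mulVec_eq_zero_of_isDissipative hP hd ih.2⟩
    rw [aeval_monomial, aeval_monomial, ← Algebra.smul_def, ← Algebra.smul_def, Matrix.smul_mulVec,
      Matrix.smul_mulVec, (hk k).1]

end Aeval

/-! ### Semistability of the closed loop of a minimal solution -/

/-- The range of a symmetric matrix is the orthogonal complement of its kernel, obtained here by
representing a functional on the dual side. -/
theorem exists_mulVec_eq_of_orthogonal_ker {ι : Type*} [Fintype ι] {P : Matrix ι ι ℝ}
    (hP : Pᵀ = P) {a : ι → ℝ} (ha : ∀ v, P *ᵥ v = 0 → a ⬝ᵥ v = 0) : ∃ y, P *ᵥ y = a := by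
  classical
  have h1 : dotProductBilin ℝ ℝ a ∈ (LinearMap.ker P.mulVecLin).dualAnnihilator := by
    rw [Submodule.mem_dualAnnihilator]
    exact fun v hv => ha v hv
  rw [← LinearMap.range_dualMap_eq_dualAnnihilator_ker] at h1
  obtain ⟨ψ, hψ⟩ := h1
  refine ⟨fun i => ψ (Pi.single i 1), ?_⟩
  have hrep : ∀ x, ψ x = (fun i => ψ (Pi.single i 1)) ⬝ᵥ x := fun x => by
    rw [LinearMap.pi_apply_eq_sum_univ ψ x, dotProduct]
    refine Finset.sum_congr rfl fun i _ => ?_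
    rw [smul_eq_mul, mul_comm]
    congr 2
    ext j
    simp [Pi.single_apply, eq_comm]
  refine dotProduct_eq _ _ fun x => ?_
  have h2 : ψ (P *ᵥ x) = a ⬝ᵥ x := LinearMap.congr_fun hψ x
  rw [← h2, hrep, mulVec_dotProduct, hP]

theorem sq_dotProduct_mulVec_le {ι : Type*} [Fintype ι] {P : Matrix ι ι ℝ} (hP : P.PosSemidef)
    (x y : ι → ℝ) : (y ⬝ᵥ P *ᵥ x) ^ 2 ≤ (y ⬝ᵥ P *ᵥ y) * (x ⬝ᵥ P *ᵥ x) := by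
  obtain ⟨hPs, hPn⟩ := posSemidef_iff_quadForm.1 hP
  have h : ∀ t : ℝ, 0 ≤ (y ⬝ᵥ P *ᵥ y) * (t * t) + 2 * (y ⬝ᵥ P *ᵥ x) * t + x ⬝ᵥ P *ᵥ x := by
    intro t
    have h1 := hPn (x + t • y)
    simp only [Matrix.mulVec_add, Matrix.mulVec_smul, add_dotProduct, smul_dotProduct,
      dotProduct_smul, dotProduct_add, smul_eq_mul] at h1
    rw [dotProduct_mulVec_swap hPs x y] at h1
    linarith
  have h2 := discrim_le_zero h
  rw [discrim] at h2
  linarith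

/-- Orthogonality to the kernel gives `a = P y`, and Cauchy–Schwarz for the form `P` does the rest.
This is what permits subtracting a small multiple of `a aᵀ` while keeping `P` semidefinite. -/
theorem exists_sq_dotProduct_le {ι : Type*} [Fintype ι] {P : Matrix ι ι ℝ} (hP : P.PosSemidef)
    {a : ι → ℝ} (ha : ∀ v, P *ᵥ v = 0 → a ⬝ᵥ v = 0) :
    ∃ c : ℝ, 0 ≤ c ∧ ∀ x, (a ⬝ᵥ x) ^ 2 ≤ c * (x ⬝ᵥ P *ᵥ x) := by
  obtain ⟨hPs, hPn⟩ := posSemidef_iff_quadForm.1 hP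
  obtain ⟨y, rfl⟩ := exists_mulVec_eq_of_orthogonal_ker hPs ha
  refine ⟨y ⬝ᵥ P *ᵥ y, hPn y, fun x => ?_⟩
  rw [mulVec_dotProduct, hPs]
  exact sq_dotProduct_mulVec_le hP x y

section Semistable

variable {ι κ σ : Type} [Fintype ι] [DecidableEq ι] [Fintype κ] [Fintype σ]
  {A : Matrix ι ι ℝ} {B : Matrix ι κ ℝ} {C : Matrix σ ι ℝ} {ρ : ℝ} {P : Matrix ι ι ℝ}

omit [DecidableEq ι] in
/-- A solution can be decreased along an unstable left eigenvector of the closed loop. -/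
theorem exists_smaller_solution (hρ : 0 < ρ) (hP : P.PosSemidef) (hd : IsDissipative A B C ρ P)
    {a b : ι → ℝ} (hab : a ≠ 0 ∨ b ≠ 0) {α β : ℝ} (hα : 0 < α)
    (haM : ∀ x, a ⬝ᵥ closedLoop A B ρ P *ᵥ x = α * (a ⬝ᵥ x) - β * (b ⬝ᵥ x))
    (hbM : ∀ x, b ⬝ᵥ closedLoop A B ρ P *ᵥ x = β * (a ⬝ᵥ x) + α * (b ⬝ᵥ x))
    (ha : ∀ v, P *ᵥ v = 0 → a ⬝ᵥ v = 0) (hb : ∀ v, P *ᵥ v = 0 → b ⬝ᵥ v = 0) :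
    ∃ P' : Matrix ι ι ℝ, P'.PosSemidef ∧ IsDissipative A B C ρ P' ∧ P'.trace < P.trace := by
  obtain ⟨hPs, hPn⟩ := posSemidef_iff_quadForm.1 hP
  obtain ⟨ca, hca, hca'⟩ := exists_sq_dotProduct_le hP ha
  obtain ⟨cb, hcb, hcb'⟩ := exists_sq_dotProduct_le hP hb
  set p := Bᵀ *ᵥ a
  set q := Bᵀ *ᵥ b
  have hp := dotProduct_self_nonneg p
  have hq := dotProduct_self_nonneg q
  have hc2 : 0 ≤ 2 * (p ⬝ᵥ p + q ⬝ᵥ q) := by positivity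
  set c₂ := 2 * (p ⬝ᵥ p + q ⬝ᵥ q) with hc₂
  -- The first bound keeps `P - s Θ` semidefinite; the second makes the quadratic term `ρ⁻¹ s²
  -- ‖BᵀΘx‖²` smaller than the linear gain `2 s α θ` in the Riccati form.
  set s := min (1 / (ca + cb + 1)) (α / (ρ⁻¹ * c₂ + 1)) with hs
  have hs0 : 0 < s := lt_min (by positivity) (by positivity)
  have hs1 : s * (ca + cb) ≤ 1 := by
    have h1 : s ≤ 1 / (ca + cb + 1) := min_le_left _ _
    rw [le_div_iff₀ (by positivity)] at h1
    linarith
  have hs2 : s * (ρ⁻¹ * c₂) ≤ α := by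
    have h1 : s ≤ α / (ρ⁻¹ * c₂ + 1) := min_le_right _ _
    rw [le_div_iff₀ (by positivity)] at h1
    linarith
  set Θ := Matrix.vecMulVec a a + Matrix.vecMulVec b b with hΘ
  have hΘx : ∀ x, Θ *ᵥ x = (a ⬝ᵥ x) • a + (b ⬝ᵥ x) • b := fun x => by
    rw [hΘ, Matrix.add_mulVec, Matrix.vecMulVec_mulVec, Matrix.vecMulVec_mulVec]
    simp
  have hDs : (-(s • Θ))ᵀ = -(s • Θ) := by
    rw [hΘ, Matrix.transpose_neg, Matrix.transpose_smul, Matrix.transpose_add,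
      Matrix.transpose_vecMulVec, Matrix.transpose_vecMulVec]
  refine ⟨P + -(s • Θ), posSemidef_iff_quadForm.2 ⟨by rw [Matrix.transpose_add, hDs, hPs],
    fun x => ?_⟩, (isDissipative_iff_riccati (by rw [Matrix.transpose_add, hDs, hPs]) hρ).2
    fun x => ?_, ?_⟩
  · rw [Matrix.add_mulVec, Matrix.neg_mulVec, Matrix.smul_mulVec, hΘx]
    simp only [dotProduct_add, dotProduct_neg, dotProduct_smul, smul_eq_mul]
    rw [dotProduct_comm x a, dotProduct_comm x b]
    have h1 : s * ((a ⬝ᵥ x) ^ 2 + (b ⬝ᵥ x) ^ 2) ≤ s * ((ca + cb) * (x ⬝ᵥ P *ᵥ x)) :=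
      mul_le_mul_of_nonneg_left (by linarith [hca' x, hcb' x]) hs0.le
    have h2 := mul_le_mul_of_nonneg_right hs1 (hPn x)
    linarith
  · rw [riccati_add hDs]
    have h1 := (isDissipative_iff_riccati hPs hρ).1 hd x
    have h2 : Bᵀ *ᵥ (-(s • Θ) *ᵥ x) = -(s • ((a ⬝ᵥ x) • p + (b ⬝ᵥ x) • q)) := by
      rw [Matrix.neg_mulVec, Matrix.smul_mulVec, hΘx, Matrix.mulVec_neg, Matrix.mulVec_smul,
        Matrix.mulVec_add, Matrix.mulVec_smul, Matrix.mulVec_smul]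
    have h3 : x ⬝ᵥ -(s • Θ) *ᵥ (closedLoop A B ρ P *ᵥ x)
        = -(s * (α * ((a ⬝ᵥ x) ^ 2 + (b ⬝ᵥ x) ^ 2))) := by
      rw [dotProduct_mulVec_swap hDs, Matrix.neg_mulVec, Matrix.smul_mulVec, hΘx]
      simp only [dotProduct_add, dotProduct_neg, dotProduct_smul, smul_eq_mul]
      rw [dotProduct_comm _ a, dotProduct_comm _ b, haM, hbM]
      ring
    have h4 : ((a ⬝ᵥ x) • p + (b ⬝ᵥ x) • q) ⬝ᵥ ((a ⬝ᵥ x) • p + (b ⬝ᵥ x) • q)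
        ≤ c₂ * ((a ⬝ᵥ x) ^ 2 + (b ⬝ᵥ x) ^ 2) := by
      have h5 := dotProduct_self_nonneg ((a ⬝ᵥ x) • p - (b ⬝ᵥ x) • q)
      simp only [sub_dotProduct, dotProduct_sub, add_dotProduct, dotProduct_add, smul_dotProduct,
        dotProduct_smul, smul_eq_mul] at h5 ⊢
      rw [hc₂]
      nlinarith [mul_nonneg hp (sq_nonneg (b ⬝ᵥ x)), mul_nonneg hq (sq_nonneg (a ⬝ᵥ x))]
    rw [h2, h3, neg_dotProduct_neg, smul_dotProduct, dotProduct_smul, smul_eq_mul, smul_eq_mul]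
    set θ := (a ⬝ᵥ x) ^ 2 + (b ⬝ᵥ x) ^ 2 with hθ
    have hθ0 : 0 ≤ θ := by positivity
    have h6 := mul_le_mul_of_nonneg_left h4 (show 0 ≤ ρ⁻¹ * (s * s) by positivity)
    have h7 := mul_le_mul_of_nonneg_right hs2 (mul_nonneg hs0.le hθ0)
    have h8 : 0 ≤ s * (α * θ) := by positivity
    linarith
  · rw [Matrix.trace_add, Matrix.trace_neg, Matrix.trace_smul, hΘ, Matrix.trace_add,
      Matrix.trace_vecMulVec, Matrix.trace_vecMulVec, smul_eq_mul]
    have h1 : 0 < a ⬝ᵥ a + b ⬝ᵥ b := by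
      rcases hab with h | h
      · exact add_pos_of_pos_of_nonneg (dotProduct_self_pos h) (dotProduct_self_nonneg b)
      · exact add_pos_of_nonneg_of_pos (dotProduct_self_nonneg a) (dotProduct_self_pos h)
    have := mul_pos hs0 h1
    linarith

/-- The closed loop of a solution of least trace has no unstable eigenvalue. -/
theorem re_nonpos_of_trace_minimal (hA : Hurwitz A) (hρ : 0 < ρ) (hP : P.PosSemidef)
    (hd : IsDissipative A B C ρ P)
    (hmin : ∀ P' : Matrix ι ι ℝ, P'.PosSemidef → IsDissipative A B C ρ P' → P.trace ≤ P'.trace) :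
    ∀ μ ∈ spectrum ℂ (toComplex (closedLoop A B ρ P)), μ.re ≤ 0 := by
  intro μ hμ
  by_contra! hre
  obtain ⟨η, hη0, hη⟩ := mem_spectrum_iff_vecMul.1 hμ
  set a : ι → ℝ := fun i => (η i).re
  set b : ι → ℝ := fun i => (η i).im
  have hdot : ∀ x : ι → ℝ, η ⬝ᵥ (fun i => (x i : ℂ)) = ⟨a ⬝ᵥ x, b ⬝ᵥ x⟩ := by
    intro x
    apply Complex.ext <;> simp [dotProduct, a, b]
  have hM : ∀ (M : Matrix ι ι ℝ) (z : ℂ), η ᵥ* toComplex M = z • η → ∀ x : ι → ℝ,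
      η ⬝ᵥ (fun i => ((M *ᵥ x) i : ℂ)) = z * η ⬝ᵥ (fun i => (x i : ℂ)) := by
    intro M z h x
    rw [← toComplex_mulVec, Matrix.dotProduct_mulVec, h, smul_dotProduct, smul_eq_mul]
  -- The left eigenvector is orthogonal to the kernel of `P`: the characteristic polynomial of `A`,
  -- evaluated at the closed loop, kills the kernel but multiplies `η` by its value at `μ`, which is
  -- nonzero because `A` is stable and `Re μ > 0`.
  have hker : ∀ v, P *ᵥ v = 0 → η ⬝ᵥ (fun i => (v i : ℂ)) = 0 := by
    intro v hv
    have h1 := hM _ _ (vecMul_toComplex_aeval hη A.charpoly) v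
    rw [aeval_closedLoop_mulVec hP hd hv, Matrix.aeval_self_charpoly] at h1
    have h2 : aeval μ A.charpoly ≠ 0 := fun h =>
      absurd (hA μ (aeval_charpoly_eq_zero_iff.1 h)) (not_lt.2 hre.le)
    have h3 : aeval μ A.charpoly * η ⬝ᵥ (fun i => (v i : ℂ)) = 0 := by
      rw [← h1]
      simp [dotProduct]
    exact (mul_eq_zero.1 h3).resolve_left h2
  have hMM := hM _ _ hη
  simp only [hdot] at hMM hker
  have hab : a ≠ 0 ∨ b ≠ 0 := by
    by_contra! h
    exact hη0 (funext fun i => Complex.ext (congrFun h.1 i) (congrFun h.2 i))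
  obtain ⟨P', h1, h2, h3⟩ := exists_smaller_solution (β := μ.im) hρ hP hd hab hre
    (fun x => by simpa using congrArg Complex.re (hMM x))
    (fun x => by have := congrArg Complex.im (hMM x); simp at this; linarith)
    (fun v hv => congrArg Complex.re (hker v hv)) (fun v hv => congrArg Complex.im (hker v hv))
  exact absurd (hmin P' h1 h2) (not_le.2 h3)

end Semistable

end FaultEst
end

noncomputable section

namespace FaultEst

open Filter Topology Polynomial

/-! ### From semidefinite to definite solutions -/

section Definite

variable {ι κ σ : Type} [Fintype ι] [DecidableEq ι] [Fintype κ] [Fintype σ]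
  {A : Matrix ι ι ℝ} {B : Matrix ι κ ℝ} {C : Matrix σ ι ℝ} {ρ : ℝ} {P : Matrix ι ι ℝ}

/-- A Fitting projection of `p(M)`, as a polynomial in `M`. -/
theorem exists_fitting_projection (M : Matrix ι ι ℝ) (p : ℝ[X]) :
    ∃ (π : Matrix ι ι ℝ) (k : ℕ), π * π = π ∧ M * π = π * M ∧ aeval M p ^ k * π = 0 ∧
      ∀ v, aeval M p *ᵥ v = 0 → π *ᵥ v = v := by
  set D := aeval M p with hD
  obtain ⟨h, hh, hnd⟩ := D.charpoly.exists_eq_pow_rootMultiplicity_mul_and_not_dvd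
    D.charpoly_monic.ne_zero 0
  set k := D.charpoly.rootMultiplicity 0
  rw [C_0, sub_zero] at hh hnd
  -- The exponent `k + 1` instead of `k` guarantees a factor `X`, so that `a X ^ (k + 1)` evaluated
  -- at `D` annihilates the kernel of `D` even when `k = 0`.
  obtain ⟨a, b, hab⟩ : IsCoprime (X ^ (k + 1)) h :=
    (irreducible_X.coprime_iff_not_dvd.2 hnd).pow_left
  have hCH : aeval D (X ^ k * h) = 0 := by rw [← hh, Matrix.aeval_self_charpoly]
  have hann : aeval D (X ^ (k + 1) * (b * h)) = 0 := by
    rw [show X ^ (k + 1) * (b * h) = X * b * (X ^ k * h) by ring, map_mul, hCH, mul_zero]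
  have hπ : aeval D (b * h) = 1 - aeval D (a * X ^ (k + 1)) := by
    rw [eq_sub_iff_add_eq, ← map_add, add_comm, hab, map_one]
  refine ⟨aeval D (b * h), k + 1, ?_, ?_, ?_, fun v hv => ?_⟩
  · nth_rewrite 2 [hπ]
    rw [mul_sub, mul_one, ← map_mul (aeval D) (b * h) (a * X ^ (k + 1)),
      show b * h * (a * X ^ (k + 1)) = a * (X ^ (k + 1) * (b * h)) by ring,
      map_mul (aeval D) a, hann, mul_zero, sub_zero]
  · have h1 : aeval D (b * h) = aeval M ((b * h).comp p) := by rw [aeval_comp]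
    have h2 : M * aeval M ((b * h).comp p) = aeval M (X * (b * h).comp p) := by
      rw [map_mul, aeval_X]
    rw [h1, h2, mul_comm, map_mul, aeval_X]
  · rw [← hann, map_mul (aeval D) (X ^ (k + 1)), map_pow, aeval_X]
  · rw [hπ, pow_succ, ← mul_assoc, map_mul, aeval_X, Matrix.sub_mulVec, Matrix.one_mulVec,
      ← Matrix.mulVec_mulVec, hv, Matrix.mulVec_zero, sub_zero]

/-- A positive semidefinite solution for a stable system can be made positive definite. -/
theorem exists_posDef_isDissipative (hA : Hurwitz A) (hρ : 0 < ρ) (hP : P.PosSemidef)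
    (hd : IsDissipative A B C ρ P) :
    ∃ P' : Matrix ι ι ℝ, P'.PosDef ∧ IsDissipative A B C ρ P' := by
  obtain ⟨hPs, hPn⟩ := posSemidef_iff_quadForm.1 hP
  set M := closedLoop A B ρ P with hM
  obtain ⟨π, k, hππ, hcomm, hnil, hfix⟩ := exists_fitting_projection M A.charpoly
  -- On the range of `π` a power of `χ_A(M)` vanishes, so the eigenvalues of `M` there are roots of
  -- `χ_A` and hence stable; the term `-(1 - π)` places `-1` on the complement.
  have hH : Hurwitz (M * π - (1 - π)) := by
    rw [hurwitz_iff_mulVec]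
    intro μ v hv he
    set y := toComplex π *ᵥ v with hy
    by_cases hy0 : y = 0
    · rw [toComplex_sub, toComplex_sub, toComplex_one, toComplex_mul, Matrix.sub_mulVec,
        Matrix.sub_mulVec, ← Matrix.mulVec_mulVec, ← hy, hy0, Matrix.mulVec_zero, Matrix.one_mulVec,
        sub_zero, zero_sub, ← neg_one_smul ℂ v] at he
      have : μ = -1 := (smul_left_injective ℂ hv he).symm
      rw [this]
      norm_num
    · have hMy : toComplex M *ᵥ y = μ • y := by
        have h1 : π * (M * π - (1 - π)) = M * π := by
          rw [mul_sub, mul_sub, mul_one, hππ, sub_self, sub_zero, ← mul_assoc, ← hcomm, mul_assoc,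
            hππ]
        rw [hy, Matrix.mulVec_mulVec, ← toComplex_mul, ← h1, toComplex_mul, ← Matrix.mulVec_mulVec,
          he, Matrix.mulVec_smul]
      have h2 := toComplex_aeval_mulVec hMy (A.charpoly ^ k)
      have h3 : toComplex (aeval M (A.charpoly ^ k)) *ᵥ y = 0 := by
        rw [hy, Matrix.mulVec_mulVec, ← toComplex_mul, map_pow, hnil]
        ext i
        simp [toComplex, Matrix.mulVec, dotProduct]
      rw [h3, map_pow] at h2
      have h4 := (smul_eq_zero.1 h2.symm).resolve_right hy0
      exact hA μ (aeval_charpoly_eq_zero_iff.1 (eq_zero_of_pow_eq_zero h4))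
  obtain ⟨Y, hY, c, hc, hYA⟩ := exists_lyapunov hH
  obtain ⟨hYs, hYp⟩ := posDef_iff_quadForm.1 hY
  have hYn := (posSemidef_iff_quadForm.1 hY.posSemidef).2
  obtain ⟨c', hc', hbd⟩ := exists_mulVec_dotProduct_le (Bᵀ * (πᵀ * Y)) (Bᵀ * (πᵀ * Y))
  set ε := c / (ρ⁻¹ * c' + 1) with hε
  have hε0 : 0 < ε := by positivity
  have hε1 : ε * (ρ⁻¹ * c') ≤ c := by
    have h1 : ε * (ρ⁻¹ * c' + 1) = c := div_mul_cancel₀ _ (by positivity)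
    linarith
  set D := ε • (πᵀ * Y * π) with hD
  have hDs : Dᵀ = D := by
    rw [hD, Matrix.transpose_smul, Matrix.transpose_mul, Matrix.transpose_mul,
      Matrix.transpose_transpose, hYs, mul_assoc]
  have hDx : ∀ x, D *ᵥ x = ε • πᵀ *ᵥ (Y *ᵥ (π *ᵥ x)) := fun x => by
    rw [hD, Matrix.smul_mulVec, ← Matrix.mulVec_mulVec, ← Matrix.mulVec_mulVec]
  have hDq : ∀ x y, x ⬝ᵥ D *ᵥ y = ε * ((π *ᵥ x) ⬝ᵥ Y *ᵥ (π *ᵥ y)) := fun x y => by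
    rw [hDx, dotProduct_smul, smul_eq_mul, ← mulVec_dotProduct]
  have hPDs : (P + D)ᵀ = P + D := by rw [Matrix.transpose_add, hPs, hDs]
  refine ⟨P + D, posDef_iff_quadForm.2 ⟨hPDs, fun x hx => ?_⟩,
    (isDissipative_iff_riccati hPDs hρ).2 fun x => ?_⟩
  · rw [Matrix.add_mulVec, dotProduct_add, hDq]
    by_cases hπx : π *ᵥ x = 0
    · rcases (hPn x).lt_or_eq with h | h
      · rw [hπx, zero_dotProduct, mul_zero, add_zero]
        exact h
      -- If both forms vanish at `x`, then `x` lies in the kernel of `P`, hence in that of `χ_A(M)`,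
      -- which `π` fixes; so `x = π x = 0`.
      · exfalso
        have h1 := mulVec_eq_zero_of_quadForm hP h.symm
        have h2 := hfix x (by
          rw [aeval_closedLoop_mulVec hP hd h1, Matrix.aeval_self_charpoly, Matrix.zero_mulVec])
        exact hx (by rw [← h2, hπx])
    · exact add_pos_of_nonneg_of_pos (hPn x) (mul_pos hε0 (hYp _ hπx))
  · rw [riccati_add hDs, ← hM]
    have h1 := (isDissipative_iff_riccati hPs hρ).1 hd x
    have h2 : π *ᵥ (M *ᵥ x) = (M * π - (1 - π)) *ᵥ (π *ᵥ x) := by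
      rw [Matrix.mulVec_mulVec, Matrix.mulVec_mulVec, sub_mul, sub_mul, one_mul, mul_assoc, hππ,
        sub_self, sub_zero, hcomm]
    have h3 := hYA (π *ᵥ x)
    have h4 := hbd (π *ᵥ x)
    have h5 : Bᵀ *ᵥ (D *ᵥ x) = ε • (Bᵀ * (πᵀ * Y)) *ᵥ (π *ᵥ x) := by
      rw [hDx, Matrix.mulVec_smul, ← Matrix.mulVec_mulVec _ Bᵀ, ← Matrix.mulVec_mulVec _ πᵀ]
    rw [hDq, h2, h5, smul_dotProduct, dotProduct_smul, smul_eq_mul, smul_eq_mul]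
    have h6 := mul_le_mul_of_nonneg_left h4 (show 0 ≤ ρ⁻¹ * (ε * ε) by positivity)
    have h7 := mul_le_mul_of_nonneg_right hε1
      (mul_nonneg hε0.le (dotProduct_self_nonneg (π *ᵥ x)))
    have h8 := mul_le_mul_of_nonneg_left h3 hε0.le
    linarith

end Definite

/-! ### Extending solutions from an invariant subspace -/

section Extension

variable {ι κ σ : Type} [Fintype ι] [DecidableEq ι] [Fintype κ] [Fintype σ]

theorem toComplex_aeval (M : Matrix ι ι ℝ) (q : ℝ[X]) :
    toComplex (aeval M q) = aeval (toComplex M) (q.map (algebraMap ℝ ℂ)) := by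
  induction q using Polynomial.induction_on' with
  | add p q hp hq => rw [map_add, toComplex_add, hp, hq, Polynomial.map_add, map_add]
  | monomial k c =>
    rw [map_monomial, aeval_monomial, aeval_monomial, ← Algebra.smul_def, ← Algebra.smul_def,
      toComplex_smul, toComplex_pow]
    rfl

/-- Solvability of a Sylvester equation. -/
theorem exists_sylvester {S T : Matrix ι ι ℝ}
    (hS : ∀ μ ∈ spectrum ℂ (toComplex S), μ.re ≤ 0) (hT : Hurwitz T) (W : Matrix ι ι ℝ) :
    ∃ Z : Matrix ι ι ℝ, Sᵀ * Z + Z * T = W := by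
  set L : Matrix ι ι ℝ →ₗ[ℝ] Matrix ι ι ℝ :=
    LinearMap.mulLeft ℝ Sᵀ + LinearMap.mulRight ℝ T with hL
  have hLZ : ∀ Z, L Z = Sᵀ * Z + Z * T := fun Z => rfl
  suffices h : Function.Injective L by
    obtain ⟨Z, hZ⟩ := LinearMap.injective_iff_surjective.1 h W
    exact ⟨Z, hZ⟩
  rw [injective_iff_map_eq_zero]
  intro Z hZ
  rw [hLZ] at hZ
  have hZ' : Sᵀ * Z = Z * (-T) := by rw [mul_neg]; exact eq_neg_of_add_eq_zero_left hZ
  have hq : ∀ q : ℝ[X], aeval Sᵀ q * Z = Z * aeval (-T) q := by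
    intro q
    induction q using Polynomial.induction_on' with
    | add p q hp hq => rw [map_add, map_add, add_mul, mul_add, hp, hq]
    | monomial k c =>
      have hk : ∀ k : ℕ, Sᵀ ^ k * Z = Z * (-T) ^ k := by
        intro k
        induction k with
        | zero => simp
        | succ k ih => rw [pow_succ, pow_succ', mul_assoc, hZ', ← mul_assoc, ih, mul_assoc, ← pow_succ,
            ← pow_succ']
      rw [aeval_monomial, aeval_monomial, ← Algebra.smul_def, ← Algebra.smul_def, smul_mul_assoc,
        mul_smul_comm, hk]
  -- A homogeneous solution intertwines `Sᵀ` and `-T`, so the characteristic polynomial of `-T` at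
  -- `Sᵀ` kills `Z`. This matrix is invertible, because `-T` has its spectrum in the open right half
  -- plane and `S` has none there.
  have h0 := hq (-T).charpoly
  rw [Matrix.aeval_self_charpoly, mul_zero] at h0
  rcases isEmpty_or_nonempty ι with hι | hι
  · exact Subsingleton.elim _ _
  have hdet : (aeval Sᵀ (-T).charpoly).det ≠ 0 := by
    intro hdet
    obtain ⟨v, hv, hv0⟩ := Matrix.exists_mulVec_eq_zero_iff.2 hdet
    have h1 : toComplex (aeval Sᵀ (-T).charpoly)
        = aeval (toComplex Sᵀ) ((-T).charpoly.map (algebraMap ℝ ℂ)) := toComplex_aeval _ _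
    have h2 : (0 : ℂ) ∈ spectrum ℂ (aeval (toComplex Sᵀ) ((-T).charpoly.map (algebraMap ℝ ℂ))) := by
      rw [← h1, mem_spectrum_iff_mulVec]
      refine ⟨fun i => (v i : ℂ), fun h => hv (funext fun i => ?_), ?_⟩
      · exact Complex.ofReal_eq_zero.1 (congrFun h i)
      · rw [toComplex_mulVec, hv0, zero_smul]
        simp only [Pi.zero_apply, Complex.ofReal_zero]
        rfl
    rw [spectrum.map_polynomial_aeval_of_nonempty _ _
      (spectrum.nonempty_of_isAlgClosed_of_finiteDimensional ℂ _)] at h2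
    obtain ⟨μ, hμ, hμ0⟩ := h2
    simp only [eval_map_algebraMap, aeval_charpoly_eq_zero_iff] at hμ0
    obtain ⟨y, hy, hye⟩ := mem_spectrum_iff_mulVec.1 hμ0
    have h3 : (-μ).re < 0 := by
      refine hurwitz_iff_mulVec.1 hT (-μ) y hy ?_
      have h4 : toComplex (-T) = -toComplex T := by ext i j; simp [toComplex]
      rw [h4, Matrix.neg_mulVec] at hye
      rw [neg_smul, ← hye, neg_neg]
    have h5 : μ ∈ spectrum ℂ (toComplex S) := by
      obtain ⟨z, hz, hze⟩ := mem_spectrum_iff_mulVec.1 hμ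
      rw [toComplex_transpose, Matrix.mulVec_transpose] at hze
      exact mem_spectrum_iff_vecMul.2 ⟨z, hz, hze⟩
    have h6 := hS μ h5
    rw [Complex.neg_re] at h3
    linarith
  have hu : IsUnit (aeval Sᵀ (-T).charpoly) :=
    (Matrix.isUnit_iff_isUnit_det _).2 (isUnit_iff_ne_zero.2 hdet)
  exact hu.mul_right_eq_zero.1 h0

/-- In the splitting `x = v + u` with `v = π x`, the component `u` evolves autonomously and is
stable. The block `Z` is chosen so that all `v`–`u` cross terms cancel after completing the square
in `w`; the remaining terms are quadratic in `u` and are absorbed by `K Y`. -/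
theorem exists_isDissipative_of_restrict {A : Matrix ι ι ℝ} {B : Matrix ι κ ℝ} {C : Matrix σ ι ℝ}
    {ρ : ℝ} {π P : Matrix ι ι ℝ} (hA : Hurwitz A) (hρ : 0 < ρ) (hππ : π * π = π)
    (hAπ : π * A * π = A * π) (hBπ : π * B = B) (hP : Pᵀ = P)
    (hd : IsDissipative (A * π - (1 - π)) B (C * π) ρ P)
    (hs : ∀ μ ∈ spectrum ℂ (toComplex (closedLoop (A * π - (1 - π)) B ρ P)), μ.re ≤ 0) :
    ∃ P' : Matrix ι ι ℝ, P'ᵀ = P' ∧ IsDissipative A B C ρ P' := by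
  set π' := 1 - π with hπ'
  have h01 : π * π' = 0 := by rw [hπ', mul_sub, mul_one, hππ, sub_self]
  have h10 : π' * π = 0 := by rw [hπ', sub_mul, one_mul, hππ, sub_self]
  have h11 : π' * π' = π' := by rw [hπ', mul_sub, mul_one, ← hπ', h10, sub_zero]
  have hT : Hurwitz (π' * A * π' - π) := by
    rw [hurwitz_iff_vecMul]
    intro μ v hv he
    by_cases hy0 : v ᵥ* toComplex π = 0
    · have h1 : v ᵥ* toComplex π' = v := by
        rw [hπ', toComplex_sub, toComplex_one, Matrix.vecMul_sub, hy0, Matrix.vecMul_one, sub_zero]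
      have h2 : π' * A * π' = π' * A := by
        rw [hπ', mul_sub, mul_one, sub_mul, sub_mul, one_mul, hAπ, sub_self, sub_zero]
      rw [h2, toComplex_sub, toComplex_mul, Matrix.vecMul_sub, hy0, sub_zero,
        ← Matrix.vecMul_vecMul, h1] at he
      exact hurwitz_iff_vecMul.1 hA μ v hv he
    · have h1 : (π' * A * π' - π) * π = -π := by
        rw [sub_mul, mul_assoc _ π', h10, mul_zero, hππ, zero_sub]
      have h2 : μ • (v ᵥ* toComplex π) = (-1 : ℂ) • (v ᵥ* toComplex π) := by
        rw [← Matrix.smul_vecMul, ← he, Matrix.vecMul_vecMul, ← toComplex_mul, h1,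
          ← neg_one_smul ℝ π, toComplex_smul, Matrix.vecMul_smul]
        simp
      have : μ = -1 := smul_left_injective ℂ hy0 h2
      rw [this]
      norm_num
  obtain ⟨Z, hZ⟩ := exists_sylvester hs hT (-(P * π * A + Cᵀ * C))
  obtain ⟨Y, hY, c, hc, hYA⟩ := exists_lyapunov hT
  obtain ⟨hYs, hYp⟩ := posDef_iff_quadForm.1 hY
  obtain ⟨c₁, hc₁, hb₁⟩ := exists_mulVec_dotProduct_le Z (π * A)
  obtain ⟨c₂, hc₂, hb₂⟩ := exists_mulVec_dotProduct_le C C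
  obtain ⟨c₃, hc₃, hb₃⟩ := exists_mulVec_dotProduct_le (Bᵀ * Z) (Bᵀ * Z)
  obtain ⟨K, hK0, hK⟩ : ∃ K : ℝ, 0 ≤ K ∧ K * c = 2 * c₁ + c₂ + ρ⁻¹ * c₃ :=
    ⟨(2 * c₁ + c₂ + ρ⁻¹ * c₃) / c, by positivity, div_mul_cancel₀ _ hc.ne'⟩
  refine ⟨πᵀ * P * π + πᵀ * Z * π' + π'ᵀ * Zᵀ * π + K • (π'ᵀ * Y * π'), ?_, ?_⟩
  · simp only [Matrix.transpose_add, Matrix.transpose_mul, Matrix.transpose_transpose,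
      Matrix.transpose_smul, hP, hYs, Matrix.mul_assoc]
    abel
  intro x w
  set v := π *ᵥ x with hv
  set u := π' *ᵥ x with hu
  have hx : x = v + u := by
    rw [hv, hu, hπ', Matrix.sub_mulVec, Matrix.one_mulVec, add_sub_cancel]
  have hπv : π *ᵥ v = v := by rw [hv, Matrix.mulVec_mulVec, hππ]
  have hπu : π *ᵥ u = 0 := by rw [hu, Matrix.mulVec_mulVec, h01, Matrix.zero_mulVec]
  have hπ'v : π' *ᵥ v = 0 := by rw [hv, Matrix.mulVec_mulVec, h10, Matrix.zero_mulVec]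
  have hπ'u : π' *ᵥ u = u := by rw [hu, Matrix.mulVec_mulVec, h11]
  have hπAv : π *ᵥ (A *ᵥ v) = A *ᵥ v := by
    rw [hv, Matrix.mulVec_mulVec, Matrix.mulVec_mulVec, hAπ, ← Matrix.mulVec_mulVec]
  have hform : ∀ y, x ⬝ᵥ (πᵀ * P * π + πᵀ * Z * π' + π'ᵀ * Zᵀ * π + K • (π'ᵀ * Y * π')) *ᵥ y
      = v ⬝ᵥ P *ᵥ (π *ᵥ y) + v ⬝ᵥ Z *ᵥ (π' *ᵥ y) + (Z *ᵥ u) ⬝ᵥ (π *ᵥ y)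
        + K * (u ⬝ᵥ Y *ᵥ (π' *ᵥ y)) := by
    intro y
    simp only [Matrix.add_mulVec, Matrix.smul_mulVec, dotProduct_add, dotProduct_smul, smul_eq_mul,
      ← Matrix.mulVec_mulVec, ← mulVec_dotProduct]
    rw [mulVec_dotProduct Z, hv, hu]
  have hy1 : π *ᵥ (A *ᵥ x + B *ᵥ w) = A *ᵥ v + π *ᵥ (A *ᵥ u) + B *ᵥ w := by
    rw [Matrix.mulVec_add, Matrix.mulVec_mulVec w, hBπ, hx, Matrix.mulVec_add, Matrix.mulVec_add,
      hπAv]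
  have hy2 : π' *ᵥ (A *ᵥ x + B *ᵥ w) = π' *ᵥ (A *ᵥ u) := by
    rw [hπ', Matrix.sub_mulVec, Matrix.sub_mulVec, hy1, Matrix.one_mulVec, Matrix.one_mulVec, hx,
      Matrix.mulVec_add]
    abel
  have hSv : closedLoop (A * π - π') B ρ P *ᵥ v = A *ᵥ v + ρ⁻¹ • (B *ᵥ (Bᵀ *ᵥ (P *ᵥ v))) := by
    rw [closedLoop_mulVec, Matrix.sub_mulVec, hπ'v, sub_zero, ← Matrix.mulVec_mulVec, hπv]
  have hTu : (π' * A * π' - π) *ᵥ u = π' *ᵥ (A *ᵥ u) := by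
    rw [Matrix.sub_mulVec, hπu, sub_zero, ← Matrix.mulVec_mulVec, hπ'u, ← Matrix.mulVec_mulVec]
  set b := Bᵀ *ᵥ (Z *ᵥ u) with hb
  have hZb : ∀ y, (Z *ᵥ u) ⬝ᵥ (B *ᵥ y) = b ⬝ᵥ y := fun y => by
    rw [hb, mulVec_dotProduct Bᵀ, Matrix.transpose_transpose]
  have hPb : ∀ y, v ⬝ᵥ P *ᵥ (B *ᵥ y) = (Bᵀ *ᵥ (P *ᵥ v)) ⬝ᵥ y := fun y => by
    rw [dotProduct_mulVec_swap hP, mulVec_dotProduct, dotProduct_comm]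
  have hcross : (A *ᵥ v) ⬝ᵥ (Z *ᵥ u) + ρ⁻¹ * ((Bᵀ *ᵥ (P *ᵥ v)) ⬝ᵥ b) + v ⬝ᵥ Z *ᵥ (π' *ᵥ (A *ᵥ u))
      + v ⬝ᵥ P *ᵥ (π *ᵥ (A *ᵥ u)) + (C *ᵥ v) ⬝ᵥ (C *ᵥ u) = 0 := by
    have h1 := congrArg (fun M => v ⬝ᵥ M *ᵥ u) hZ
    simp only [Matrix.add_mulVec, Matrix.neg_mulVec, dotProduct_add, dotProduct_neg,
      ← Matrix.mulVec_mulVec _ _ (_ : Matrix ι ι ℝ)] at h1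
    rw [hTu, ← mulVec_dotProduct, hSv,
      add_dotProduct, smul_dotProduct, smul_eq_mul, dotProduct_comm (B *ᵥ _), hZb,
      dotProduct_comm b, ← Matrix.mulVec_mulVec _ Cᵀ, ← mulVec_dotProduct C] at h1
    linarith
  -- The shift by `ρ⁻¹ Bᵀ Z u` absorbs the coupling of `w` with `u`, at the price of `ρ⁻¹ ‖b‖²`,
  -- which `c₃` bounds.
  have hdv := hd v (w - ρ⁻¹ • b)
  rw [Matrix.sub_mulVec, hπ'v, sub_zero, ← Matrix.mulVec_mulVec, ← Matrix.mulVec_mulVec, hπv,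
    Matrix.mulVec_add, dotProduct_add, hPb] at hdv
  simp only [sub_dotProduct, dotProduct_sub, smul_dotProduct, dotProduct_smul, smul_eq_mul] at hdv
  rw [dotProduct_comm w b] at hdv
  have h1 := hb₁ u
  have h2 := hb₂ u
  have h3 := hb₃ u
  rw [← Matrix.mulVec_mulVec] at h1
  rw [← Matrix.mulVec_mulVec, ← hb] at h3
  have h4 := hYA u
  rw [hTu] at h4
  have h5 := mul_le_mul_of_nonneg_left h4 hK0
  have h6 := mul_le_mul_of_nonneg_left h3 (inv_pos.2 hρ).le
  have hρ' : ρ * ρ⁻¹ = 1 := mul_inv_cancel₀ hρ.ne'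
  have hsq : ρ * (w ⬝ᵥ w - ρ⁻¹ * b ⬝ᵥ w - ρ⁻¹ * (b ⬝ᵥ w - ρ⁻¹ * b ⬝ᵥ b))
      = ρ * (w ⬝ᵥ w) - 2 * b ⬝ᵥ w + ρ⁻¹ * b ⬝ᵥ b := by
    linear_combination (-2 * b ⬝ᵥ w + ρ⁻¹ * b ⬝ᵥ b) * hρ'
  rw [hsq] at hdv
  have hKu : K * (-c * (u ⬝ᵥ u)) = -(2 * c₁ + c₂ + ρ⁻¹ * c₃) * (u ⬝ᵥ u) := by
    rw [← hK]
    ring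
  rw [hKu] at h5
  have hCx : (C *ᵥ x) ⬝ᵥ (C *ᵥ x) = (C *ᵥ v) ⬝ᵥ (C *ᵥ v) + 2 * ((C *ᵥ v) ⬝ᵥ (C *ᵥ u))
      + (C *ᵥ u) ⬝ᵥ (C *ᵥ u) := by
    rw [hx, Matrix.mulVec_add, add_dotProduct, dotProduct_add, dotProduct_add,
      dotProduct_comm (C *ᵥ u)]
    ring
  rw [hform, hy1, hy2, hCx, Matrix.mulVec_add, Matrix.mulVec_add, dotProduct_add, dotProduct_add,
    dotProduct_add, dotProduct_add, hPb, hZb, dotProduct_comm (Z *ᵥ u) (A *ᵥ v)]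
  linarith

end Extension

end FaultEst
end

noncomputable section

namespace FaultEst

open MeasureTheory Filter Topology

/-! ### Trajectories with bounded inputs -/

section Trajectories

variable {ι κ σ : Type} [Fintype ι] [Fintype κ] [Fintype σ]

/-- A trajectory of `x' = A x + B w` on `[0, ∞)` with bounded measurable input, in the sense of right
derivatives. -/
structure IsTraj (A : Matrix ι ι ℝ) (B : Matrix ι κ ℝ) (e : ℝ → ι → ℝ) (w : ℝ → κ → ℝ) : Prop where
  cont : Continuous e
  meas : Measurable w
  bdd : ∃ M : ℝ, ∀ t i, |w t i| ≤ M
  deriv : ∀ t, 0 ≤ t → HasDerivWithinAt e (A *ᵥ e t + B *ᵥ w t) (Set.Ici t) t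

/-- The accumulated cost `∫₀ᵀ ‖C x‖² - ρ ‖w‖²`. -/
def cost (C : Matrix σ ι ℝ) (ρ : ℝ) (e : ℝ → ι → ℝ) (w : ℝ → κ → ℝ) (T : ℝ) : ℝ :=
  ∫ t in (0 : ℝ)..T, ((C *ᵥ e t) ⬝ᵥ (C *ᵥ e t) - ρ * (w t ⬝ᵥ w t))

variable {A : Matrix ι ι ℝ} {B : Matrix ι κ ℝ} (C : Matrix σ ι ℝ) (ρ : ℝ)
  {e e₁ e₂ : ℝ → ι → ℝ} {w w₁ w₂ : ℝ → κ → ℝ}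

theorem intervalIntegrable_of_bounded {f : ℝ → ℝ} (hf : Measurable f) {M : ℝ} (hM : ∀ t, |f t| ≤ M)
    (a b : ℝ) : IntervalIntegrable f volume a b :=
  (intervalIntegrable_const (c := M)).mono_fun hf.aestronglyMeasurable
    (Eventually.of_forall fun t => (hM t).trans (le_abs_self M))

theorem IsTraj.intervalIntegrable_input (h : IsTraj A B e w) (i : κ) (a b : ℝ) :
    IntervalIntegrable (fun t => w t i) volume a b := by
  obtain ⟨M, hM⟩ := h.bdd
  exact intervalIntegrable_of_bounded ((measurable_pi_apply i).comp h.meas) (fun t => hM t i) a b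

theorem IsTraj.intervalIntegrable_input_sq (h : IsTraj A B e w) (a b : ℝ) :
    IntervalIntegrable (fun t => w t ⬝ᵥ w t) volume a b := by
  obtain ⟨M, hM⟩ := h.bdd
  refine intervalIntegrable_sum fun i => ?_
  refine intervalIntegrable_of_bounded (M := M * M) (by have := h.meas; fun_prop) (fun t => ?_) a b
  rw [abs_mul]
  exact mul_le_mul (hM t i) (hM t i) (abs_nonneg _) ((abs_nonneg _).trans (hM t i))

theorem IsTraj.intervalIntegrable_cost (h : IsTraj A B e w) (a b : ℝ) :
    IntervalIntegrable (fun t => (C *ᵥ e t) ⬝ᵥ (C *ᵥ e t) - ρ * (w t ⬝ᵥ w t)) volume a b := by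
  have h1 : Continuous fun t => (C *ᵥ e t) ⬝ᵥ (C *ᵥ e t) := by
    have := h.cont
    fun_prop
  exact (h1.intervalIntegrable _ _).sub ((h.intervalIntegrable_input_sq a b).const_mul ρ)

theorem IsTraj.intervalIntegrable_rhs (h : IsTraj A B e w) (a b : ℝ) :
    IntervalIntegrable (fun t => A *ᵥ e t + B *ᵥ w t) volume a b := by
  have h1 : Continuous fun t => A *ᵥ e t := by
    have := h.cont
    fun_prop
  refine (h1.intervalIntegrable _ _).add ?_
  have h2 : ∀ i, IntervalIntegrable (fun t => (B *ᵥ w t) i) volume a b := fun i =>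
    intervalIntegrable_sum fun j => (h.intervalIntegrable_input j a b).const_mul (B i j)
  exact ⟨Integrable.of_eval fun i => (h2 i).1, Integrable.of_eval fun i => (h2 i).2⟩

theorem IsTraj.eq_integral (h : IsTraj A B e w) {t : ℝ} (ht : 0 ≤ t) :
    e t = e 0 + ∫ s in (0 : ℝ)..t, (A *ᵥ e s + B *ᵥ w s) := by
  rw [intervalIntegral.integral_eq_sub_of_hasDeriv_right_of_le ht h.cont.continuousOn
    (fun s hs => (h.deriv s hs.1.le).mono Set.Ioi_subset_Ici_self) (h.intervalIntegrable_rhs 0 t),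
    add_sub_cancel]

theorem IsTraj.combine (h₁ : IsTraj A B e₁ w₁) (h₂ : IsTraj A B e₂ w₂) (a b : ℝ) :
    IsTraj A B (fun t => a • e₁ t + b • e₂ t) (fun t => a • w₁ t + b • w₂ t) where
  cont := (h₁.cont.const_smul a).add (h₂.cont.const_smul b)
  meas := (h₁.meas.const_smul a).add (h₂.meas.const_smul b)
  bdd := by
    obtain ⟨M₁, hM₁⟩ := h₁.bdd
    obtain ⟨M₂, hM₂⟩ := h₂.bdd
    refine ⟨|a| * M₁ + |b| * M₂, fun t i => ?_⟩
    have h := abs_add_le (a * w₁ t i) (b * w₂ t i)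
    rw [abs_mul, abs_mul] at h
    exact h.trans <| add_le_add (mul_le_mul_of_nonneg_left (hM₁ t i) (abs_nonneg _))
      (mul_le_mul_of_nonneg_left (hM₂ t i) (abs_nonneg _))
  deriv := fun t ht => by
    refine (((h₁.deriv t ht).const_smul a).add ((h₂.deriv t ht).const_smul b)).congr_deriv ?_
    simp only [Matrix.mulVec_add, Matrix.mulVec_smul, smul_add]
    abel

/-- The cost is a quadratic form on the linear space of trajectories; this identity is the source of
the quadratic nature of the storage. -/
theorem cost_parallelogram (h₁ : IsTraj A B e₁ w₁) (h₂ : IsTraj A B e₂ w₂) (T : ℝ) :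
    cost C ρ (fun t => (1 : ℝ) • e₁ t + (1 : ℝ) • e₂ t) (fun t => (1 : ℝ) • w₁ t + (1 : ℝ) • w₂ t) T
      + cost C ρ (fun t => (1 : ℝ) • e₁ t + (-1 : ℝ) • e₂ t)
        (fun t => (1 : ℝ) • w₁ t + (-1 : ℝ) • w₂ t) T
      = 2 * cost C ρ e₁ w₁ T + 2 * cost C ρ e₂ w₂ T := by
  unfold cost
  rw [← intervalIntegral.integral_add ((h₁.combine h₂ 1 1).intervalIntegrable_cost C ρ 0 T)
    ((h₁.combine h₂ 1 (-1)).intervalIntegrable_cost C ρ 0 T), ← intervalIntegral.integral_const_mul,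
    ← intervalIntegral.integral_const_mul,
    ← intervalIntegral.integral_add ((h₁.intervalIntegrable_cost C ρ 0 T).const_mul 2)
      ((h₂.intervalIntegrable_cost C ρ 0 T).const_mul 2)]
  refine intervalIntegral.integral_congr fun t _ => ?_
  simp only [Matrix.mulVec_add, Matrix.mulVec_smul, add_dotProduct, dotProduct_add, smul_dotProduct,
    dotProduct_smul, smul_eq_mul]
  ring

theorem IsTraj.smul (h : IsTraj A B e w) (a : ℝ) :
    IsTraj A B (fun t => a • e t) (fun t => a • w t) := by
  simpa using h.combine h a 0

theorem cost_smul (a T : ℝ) :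
    cost C ρ (fun t => a • e t) (fun t => a • w t) T = a ^ 2 * cost C ρ e w T := by
  unfold cost
  rw [← intervalIntegral.integral_const_mul]
  refine intervalIntegral.integral_congr fun t _ => ?_
  simp only [Matrix.mulVec_smul, smul_dotProduct, dotProduct_smul, smul_eq_mul]
  ring

/-- Concatenation of trajectories. -/
theorem IsTraj.concat (h₁ : IsTraj A B e₁ w₁) (h₂ : IsTraj A B e₂ w₂) {h : ℝ} (hh : 0 ≤ h)
    (he : e₂ 0 = e₁ h) {T : ℝ} (hT : 0 ≤ T) :
    ∃ e w, IsTraj A B e w ∧ e 0 = e₁ 0 ∧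
      cost C ρ e w (h + T) = cost C ρ e₁ w₁ h + cost C ρ e₂ w₂ T := by
  set e : ℝ → ι → ℝ := fun t => if t ≤ h then e₁ t else e₂ (t - h) with hedef
  -- The inequality is strict for the input, unlike for the state, so that at the junction `h` the
  -- right derivative is governed by the second input.
  set w : ℝ → κ → ℝ := fun t => if t < h then w₁ t else w₂ (t - h) with hwdef
  have he1 : ∀ t, t ≤ h → e t = e₁ t := fun t ht => if_pos ht
  have he2 : ∀ t, h ≤ t → e t = e₂ (t - h) := fun t ht => by
    rcases ht.eq_or_lt with rfl | ht
    · rw [he1 _ le_rfl, sub_self, he]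
    · exact if_neg (not_le.2 ht)
  have hw1 : ∀ t, t < h → w t = w₁ t := fun t ht => if_pos ht
  have hw2 : ∀ t, h ≤ t → w t = w₂ (t - h) := fun t ht => if_neg (not_lt.2 ht)
  have htraj : IsTraj A B e w :=
    { cont := by
        refine Continuous.if_le h₁.cont (h₂.cont.comp (continuous_id.sub continuous_const))
          continuous_id continuous_const fun t ht => ?_
        have ht : t = h := ht
        simp [ht, he]
      meas := Measurable.ite measurableSet_Iio h₁.meas
        (h₂.meas.comp (measurable_id.sub measurable_const))
      bdd := by
        obtain ⟨M₁, hM₁⟩ := h₁.bdd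
        obtain ⟨M₂, hM₂⟩ := h₂.bdd
        refine ⟨max M₁ M₂, fun t i => ?_⟩
        rcases lt_or_ge t h with ht | ht
        · rw [hw1 t ht]
          exact (hM₁ t i).trans (le_max_left _ _)
        · rw [hw2 t ht]
          exact (hM₂ _ i).trans (le_max_right _ _)
      deriv := fun t ht => by
        rcases lt_or_ge t h with hth | hth
        · rw [hw1 t hth, he1 t hth.le]
          refine (h₁.deriv t ht).congr_of_eventuallyEq ?_ (he1 t hth.le)
          filter_upwards [mem_nhdsWithin_of_mem_nhds (Iio_mem_nhds hth)] with s hs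
          exact he1 s (le_of_lt hs)
        · rw [hw2 t hth, he2 t hth]
          have h3 : HasDerivWithinAt (fun s => s - h) 1 (Set.Ici t) t :=
            ((hasDerivAt_id t).sub_const h).hasDerivWithinAt
          have h4 := (h₂.deriv (t - h) (sub_nonneg.2 hth)).scomp t h3
            (fun s hs => sub_le_sub_right (Set.mem_Ici.1 hs) h)
          rw [one_smul] at h4
          exact h4.congr (fun s hs => he2 s (hth.trans hs)) (he2 t hth) }
  refine ⟨e, w, htraj, he1 0 hh, ?_⟩
  unfold cost
  rw [← intervalIntegral.integral_add_adjacent_intervals (htraj.intervalIntegrable_cost C ρ 0 h)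
    (htraj.intervalIntegrable_cost C ρ h (h + T))]
  congr 1
  · refine intervalIntegral.integral_congr_ae ?_
    have hne : ∀ᵐ t : ℝ, t ≠ h := by simp [ae_iff]
    filter_upwards [hne] with t hne ht
    rw [Set.uIoc_of_le hh] at ht
    rw [he1 t ht.2, hw1 t (lt_of_le_of_ne ht.2 hne)]
  · have h5 := intervalIntegral.integral_comp_sub_right (a := h) (b := h + T)
      (fun t => (C *ᵥ e₂ t) ⬝ᵥ (C *ᵥ e₂ t) - ρ * (w₂ t ⬝ᵥ w₂ t)) h
    rw [sub_self, add_sub_cancel_left] at h5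
    rw [← h5]
    refine intervalIntegral.integral_congr fun t ht => ?_
    rw [Set.uIcc_of_le (by linarith)] at ht
    simp only [he2 t ht.1, hw2 t ht.1]

/-- Trajectories with constant input. -/
theorem exists_isTraj_const (A : Matrix ι ι ℝ) (B : Matrix ι κ ℝ) (x : ι → ℝ) (w₀ : κ → ℝ) :
    ∃ e, IsTraj A B e (fun _ => w₀) ∧ e 0 = x := by
  -- The constant input is carried as an additional coordinate with zero derivative, which makes the
  -- system homogeneous and solvable by the operator exponential.
  set L : ((ι → ℝ) × ℝ) →L[ℝ] ((ι → ℝ) × ℝ) :=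
    LinearMap.toContinuousLinearMap
      ((A.mulVecLin.comp (LinearMap.fst ℝ _ _) +
        (LinearMap.toSpanSingleton ℝ _ (B *ᵥ w₀)).comp (LinearMap.snd ℝ _ _)).prod 0) with hL
  have hLz : ∀ z, L z = (A *ᵥ z.1 + z.2 • (B *ᵥ w₀), 0) := fun z => rfl
  set z : ℝ → (ι → ℝ) × ℝ := fun t => NormedSpace.exp (t • L) (x, 1) with hz
  have hz0 : z 0 = (x, 1) := by simp [hz]
  have hder : ∀ t, HasDerivAt z (L (z t)) t := by
    intro t
    have h1 := (hasDerivAt_exp_smul_const' (𝕂 := ℝ) L t).clm_apply (hasDerivAt_const t (x, (1 : ℝ)))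
    simpa using h1
  have hsnd : ∀ t, (z t).2 = 1 := by
    have h1 : ∀ t, HasDerivAt (fun t => (z t).2) 0 t := fun t => by
      have := (hder t).snd
      rwa [hLz] at this
    intro t
    rw [is_const_of_deriv_eq_zero (fun t => (h1 t).differentiableAt) (fun t => (h1 t).deriv) t 0,
      hz0]
  have hfst : ∀ t, HasDerivAt (fun t => (z t).1) (A *ᵥ (z t).1 + B *ᵥ w₀) t := fun t => by
    have := (hder t).fst
    rwa [hLz, hsnd, one_smul] at this
  refine ⟨fun t => (z t).1, ⟨?_, measurable_const, ?_, fun t _ => (hfst t).hasDerivWithinAt⟩, ?_⟩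
  · exact continuous_iff_continuousAt.2 fun t => (hfst t).continuousAt
  · exact ⟨∑ i, |w₀ i|, fun _ i =>
      Finset.single_le_sum (f := fun i => |w₀ i|) (fun _ _ => abs_nonneg _) (Finset.mem_univ i)⟩
  · simp only [hz0]

end Trajectories

end FaultEst
end

noncomputable section

namespace FaultEst

open MeasureTheory Filter Topology

/-! ### Quadratic forms from the parallelogram identity -/

theorem additive_eq_mul_of_bounded {f : ℝ → ℝ} (hadd : ∀ a b, f (a + b) = f a + f b) {K : ℝ}
    (hK : ∀ c, |c| ≤ 1 → |f c| ≤ K) (c : ℝ) : f c = c * f 1 := by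
  set g : ℝ →+ ℝ := AddMonoidHom.mk' f hadd
  have hg : Continuous g := by
    refine g.continuous_of_isBounded_nhds_zero (Metric.closedBall_mem_nhds 0 one_pos)
      (isBounded_iff_forall_norm_le.2 ⟨K, ?_⟩)
    rintro _ ⟨c, hc, rfl⟩
    exact hK c (by simpa using hc)
  have := map_real_smul g hg c 1
  simpa [g] using this

/-- Jordan–von Neumann: the polarization is biadditive. Nonnegativity of `S` bounds it locally, and
this replaces continuity in passing to real homogeneity. -/
theorem exists_matrix_of_parallelogram {ι : Type*} [Fintype ι] {S : (ι → ℝ) → ℝ}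
    (hS0 : ∀ x, 0 ≤ S x) (hsmul : ∀ (c : ℝ) x, S (c • x) = c ^ 2 * S x)
    (hpar : ∀ x y, S (x + y) + S (x - y) = 2 * S x + 2 * S y) :
    ∃ P : Matrix ι ι ℝ, Pᵀ = P ∧ ∀ x, S x = x ⬝ᵥ P *ᵥ x := by
  classical
  set T : (ι → ℝ) → (ι → ℝ) → ℝ := fun x y => (S (x + y) - S x - S y) / 2 with hT
  have hcomm : ∀ x y, T x y = T y x := fun x y => by
    simp only [hT]
    rw [add_comm x y]
    ring
  have hadd : ∀ x z y, T (x + z) y = T x y + T z y := by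
    intro x z y
    have h1 := hpar (x + y) z
    have h2 := hpar (x + z) y
    have h3 := hpar x (y - z)
    have h4 := hpar y z
    rw [show x + z + y = x + y + z by abel] at h2
    rw [show x + (y - z) = x + y - z by abel, show x - (y - z) = x + z - y by abel] at h3
    simp only [hT]
    rw [show x + z + y = x + y + z by abel, show z + y = y + z by abel]
    linarith
  have hT0 : ∀ y, T 0 y = 0 := fun y => by
    have := hadd 0 0 y
    rw [add_zero] at this
    linarith
  have hneg : ∀ x y, T (-x) y = -T x y := fun x y => by
    have := hadd x (-x) y
    rw [add_neg_cancel, hT0] at this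
    linarith
  have hbd : ∀ (c : ℝ) x y, -(c ^ 2 * S x + S y) / 2 ≤ T (c • x) y := fun c x y => by
    simp only [hT]
    rw [hsmul]
    linarith [hS0 (c • x + y)]
  have hhom : ∀ (c : ℝ) x y, T (c • x) y = c * T x y := by
    intro c x y
    have h := additive_eq_mul_of_bounded (f := fun c => T (c • x) y) (K := (S x + S y) / 2)
      (fun a b => by rw [add_smul, hadd]) (fun c hc => by
        have hc2 : c ^ 2 ≤ 1 := (sq_le_one_iff_abs_le_one c).2 hc
        have h1 := hbd c x y
        have h2 := hbd (-c) x y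
        rw [neg_smul, hneg, neg_sq] at h2
        have h3 := mul_le_mul_of_nonneg_right hc2 (hS0 x)
        exact abs_le.2 ⟨by linarith, by linarith⟩) c
    simpa using h
  set Bm : (ι → ℝ) →ₗ[ℝ] (ι → ℝ) →ₗ[ℝ] ℝ := LinearMap.mk₂ ℝ T hadd hhom
    (fun x y z => by rw [hcomm, hadd, hcomm y, hcomm z])
    (fun c x y => by rw [hcomm, hhom, hcomm, smul_eq_mul]) with hBm
  have hrep : ∀ x y, T x y = x ⬝ᵥ (LinearMap.toMatrix₂' ℝ Bm) *ᵥ y := fun x y => by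
    rw [← Matrix.toLinearMap₂'_apply', Matrix.toLinearMap₂'_toMatrix']
    rfl
  refine ⟨LinearMap.toMatrix₂' ℝ Bm, ?_, fun x => ?_⟩
  · ext i j
    rw [Matrix.transpose_apply, LinearMap.toMatrix₂'_apply, LinearMap.toMatrix₂'_apply]
    exact hcomm _ _
  · rw [← hrep]
    simp only [hT]
    rw [← two_smul ℝ x, hsmul]
    ring

/-! ### Available storage -/

section Storage

variable {ι κ σ : Type} [Fintype ι] [Fintype κ] [Fintype σ]

/-- All costs that can be accumulated from the state `x`. -/
def costSet (A : Matrix ι ι ℝ) (B : Matrix ι κ ℝ) (C : Matrix σ ι ℝ) (ρ : ℝ) (x : ι → ℝ) : Set ℝ :=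
  {c | ∃ e w T, 0 ≤ T ∧ IsTraj A B e w ∧ e 0 = x ∧ cost C ρ e w T = c}

/-- The supremum of the costs from `x`. -/
def availableStorage (A : Matrix ι ι ℝ) (B : Matrix ι κ ℝ) (C : Matrix σ ι ℝ) (ρ : ℝ)
    (x : ι → ℝ) : ℝ := sSup (costSet A B C ρ x)

variable {A : Matrix ι ι ℝ} {B : Matrix ι κ ℝ} {C : Matrix σ ι ℝ} {ρ : ℝ}

theorem zero_mem_costSet (x : ι → ℝ) : 0 ∈ costSet A B C ρ x := by
  obtain ⟨e, he, he0⟩ := exists_isTraj_const A B x 0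
  exact ⟨e, _, 0, le_rfl, he, he0, by simp [cost]⟩

theorem sq_mul_mem_costSet {x : ι → ℝ} {c : ℝ} (hc : c ∈ costSet A B C ρ x) (a : ℝ) :
    a ^ 2 * c ∈ costSet A B C ρ (a • x) := by
  obtain ⟨e, w, T, hT, he, rfl, rfl⟩ := hc
  exact ⟨_, _, T, hT, he.smul a, rfl, cost_smul C ρ a T⟩

theorem cost_add_mem_costSet {e : ℝ → ι → ℝ} {w : ℝ → κ → ℝ} (he : IsTraj A B e w) {h : ℝ}
    (hh : 0 ≤ h) {c : ℝ} (hc : c ∈ costSet A B C ρ (e h)) :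
    cost C ρ e w h + c ∈ costSet A B C ρ (e 0) := by
  obtain ⟨e', w', T, hT, he', he0, rfl⟩ := hc
  obtain ⟨e'', w'', h1, h2, h3⟩ := he.concat C ρ he' hh he0 hT
  exact ⟨e'', w'', h + T, add_nonneg hh hT, h1, h2, h3⟩

theorem cost_zero_input_nonneg (e : ℝ → ι → ℝ) {T : ℝ} (hT : 0 ≤ T) :
    0 ≤ cost C ρ e (fun _ => (0 : κ → ℝ)) T := by
  refine intervalIntegral.integral_nonneg hT fun t _ => ?_
  simpa using dotProduct_self_nonneg (C *ᵥ e t)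

/-- Prolonging the horizon with zero input does not decrease the cost. -/
theorem exists_cost_ge {x : ι → ℝ} {c : ℝ} (hc : c ∈ costSet A B C ρ x) :
    ∃ T₀, 0 ≤ T₀ ∧ ∀ T, T₀ ≤ T → ∃ e w, IsTraj A B e w ∧ e 0 = x ∧ c ≤ cost C ρ e w T := by
  obtain ⟨e, w, T₀, hT₀, he, rfl, rfl⟩ := hc
  refine ⟨T₀, hT₀, fun T hT => ?_⟩
  obtain ⟨e', he', he0⟩ := exists_isTraj_const A B (e T₀) 0
  obtain ⟨e'', w'', h1, h2, h3⟩ := he.concat C ρ he' hT₀ he0 (sub_nonneg.2 hT)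
  rw [add_sub_cancel] at h3
  refine ⟨e'', w'', h1, h2, ?_⟩
  rw [h3]
  linarith [cost_zero_input_nonneg (C := C) (ρ := ρ) (κ := κ) e' (sub_nonneg.2 hT)]

/-- Both trajectories are prolonged by zero input to a common horizon; their sum and difference then
satisfy the parallelogram identity. -/
theorem exists_costSet_add_ge {x y : ι → ℝ} {c d : ℝ} (hc : c ∈ costSet A B C ρ x)
    (hd : d ∈ costSet A B C ρ y) :
    ∃ c' ∈ costSet A B C ρ (x + y), ∃ d' ∈ costSet A B C ρ (x - y), 2 * c + 2 * d ≤ c' + d' := by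
  obtain ⟨T₁, hT₁, h₁⟩ := exists_cost_ge hc
  obtain ⟨T₂, hT₂, h₂⟩ := exists_cost_ge hd
  obtain ⟨e₁, w₁, he₁, rfl, hc₁⟩ := h₁ (max T₁ T₂) (le_max_left _ _)
  obtain ⟨e₂, w₂, he₂, rfl, hc₂⟩ := h₂ (max T₁ T₂) (le_max_right _ _)
  have hT : 0 ≤ max T₁ T₂ := hT₁.trans (le_max_left _ _)
  refine ⟨_, ⟨_, _, _, hT, he₁.combine he₂ 1 1, by simp, rfl⟩, _,
    ⟨_, _, _, hT, he₁.combine he₂ 1 (-1), by simp [sub_eq_add_neg], rfl⟩, ?_⟩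
  rw [cost_parallelogram C ρ he₁ he₂]
  linarith

theorem bddAbove_costSet_add {x y : ι → ℝ} (hx : BddAbove (costSet A B C ρ x))
    (hy : BddAbove (costSet A B C ρ y)) : BddAbove (costSet A B C ρ (x + y)) := by
  obtain ⟨M, hM⟩ := hx
  obtain ⟨N, hN⟩ := hy
  have key : ∀ {z : ι → ℝ} {L : ℝ}, L ∈ upperBounds (costSet A B C ρ z) →
      ∀ c ∈ costSet A B C ρ ((2 : ℝ) • z), c ≤ 4 * L := by
    intro z L hL c hc
    have h1 := sq_mul_mem_costSet hc (2 : ℝ)⁻¹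
    rw [inv_smul_smul₀ two_ne_zero] at h1
    linarith [hL h1]
  refine ⟨2 * M + 2 * N, fun c hc => ?_⟩
  -- Pairing `x + y` with `x - y`, whose cost may be taken to be 0, leads to the states `2x` and
  -- `2y`, where the costs are at most `4M` and `4N`.
  obtain ⟨c', hc', d', hd', h⟩ := exists_costSet_add_ge hc (zero_mem_costSet (x - y))
  rw [show x + y + (x - y) = (2 : ℝ) • x by rw [two_smul]; abel] at hc'
  rw [show x + y - (x - y) = (2 : ℝ) • y by rw [two_smul]; abel] at hd'
  linarith [key hM _ hc', key hN _ hd']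

theorem bddAbove_costSet_smul {x : ι → ℝ} (hx : BddAbove (costSet A B C ρ x))
    (h0 : BddAbove (costSet A B C ρ 0)) (a : ℝ) : BddAbove (costSet A B C ρ (a • x)) := by
  by_cases ha : a = 0
  · rwa [ha, zero_smul]
  obtain ⟨M, hM⟩ := hx
  refine ⟨a ^ 2 * M, fun c hc => ?_⟩
  have h1 := sq_mul_mem_costSet hc a⁻¹
  rw [inv_smul_smul₀ ha] at h1
  have h2 := mul_le_mul_of_nonneg_left (hM h1) (sq_nonneg a)
  rwa [← mul_assoc, ← mul_pow, mul_inv_cancel₀ ha, one_pow, one_mul] at h2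

theorem bddAbove_costSet_of_traj {e : ℝ → ι → ℝ} {w : ℝ → κ → ℝ} (he : IsTraj A B e w)
    (hx : BddAbove (costSet A B C ρ (e 0))) {h : ℝ} (hh : 0 ≤ h) :
    BddAbove (costSet A B C ρ (e h)) := by
  obtain ⟨M, hM⟩ := hx
  refine ⟨M - cost C ρ e w h, fun c hc => ?_⟩
  linarith [hM (cost_add_mem_costSet he hh hc)]

/-- The states of finite available storage. -/
def finiteStates (A : Matrix ι ι ℝ) (B : Matrix ι κ ℝ) (C : Matrix σ ι ℝ) (ρ : ℝ)
    (h0 : BddAbove (costSet A B C ρ 0)) : Submodule ℝ (ι → ℝ) where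
  carrier := {x | BddAbove (costSet A B C ρ x)}
  add_mem' := bddAbove_costSet_add
  zero_mem' := h0
  smul_mem' := fun a _ hx => bddAbove_costSet_smul hx h0 a

/-- Trajectories starting in the subspace stay in it, and a finite dimensional subspace is closed;
so it contains their initial velocity, for every constant input. -/
theorem mulVec_add_mem_finiteStates (h0 : BddAbove (costSet A B C ρ 0)) {x : ι → ℝ}
    (hx : x ∈ finiteStates A B C ρ h0) (w : κ → ℝ) :
    A *ᵥ x + B *ᵥ w ∈ finiteStates A B C ρ h0 := by
  obtain ⟨e, he, rfl⟩ := exists_isTraj_const A B x w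
  have hd := (he.deriv 0 le_rfl).mono Set.Ioi_subset_Ici_self
  rw [hasDerivWithinAt_iff_tendsto_slope' (by simp)] at hd
  refine (Submodule.closed_of_finiteDimensional (finiteStates A B C ρ h0)).mem_of_tendsto hd ?_
  filter_upwards [self_mem_nhdsWithin] with t ht
  rw [slope_def_module]
  exact Submodule.smul_mem _ _ (Submodule.sub_mem _ (bddAbove_costSet_of_traj he hx (le_of_lt ht)) hx)

/-- If the available storage is finite everywhere, it is a positive semidefinite quadratic form which
satisfies the dissipation inequality. -/
theorem exists_posSemidef_isDissipative (hfin : ∀ x, BddAbove (costSet A B C ρ x)) :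
    ∃ P : Matrix ι ι ℝ, P.PosSemidef ∧ IsDissipative A B C ρ P := by
  set S := availableStorage A B C ρ with hS
  have hne : ∀ x, (costSet A B C ρ x).Nonempty := fun x => ⟨0, zero_mem_costSet x⟩
  have hle : ∀ x, ∀ c ∈ costSet A B C ρ x, c ≤ S x := fun x c hc => le_csSup (hfin x) hc
  have hS0 : ∀ x, 0 ≤ S x := fun x => hle x 0 (zero_mem_costSet x)
  have hge : ∀ (c : ℝ) x, c ^ 2 * S x ≤ S (c • x) := by
    intro c x
    by_cases hc : c = 0
    · simpa [hc] using hS0 0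
    have hc2 : 0 < c ^ 2 := by positivity
    rw [mul_comm, ← le_div_iff₀ hc2]
    refine csSup_le (hne x) fun d hd => ?_
    rw [le_div_iff₀ hc2, mul_comm]
    exact hle _ _ (sq_mul_mem_costSet hd c)
  have hsmul : ∀ (c : ℝ) x, S (c • x) = c ^ 2 * S x := by
    intro c x
    refine le_antisymm ?_ (hge c x)
    by_cases hc : c = 0
    · have h1 := hge 2 (0 : ι → ℝ)
      rw [smul_zero] at h1
      simp only [hc, zero_smul]
      linarith [hS0 0]
    · have h1 := hge c⁻¹ (c • x)
      rw [inv_smul_smul₀ hc] at h1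
      have h2 := mul_le_mul_of_nonneg_left h1 (sq_nonneg c)
      rwa [← mul_assoc, ← mul_pow, mul_inv_cancel₀ hc, one_pow, one_mul] at h2
  have hpar1 : ∀ x y, 2 * S x + 2 * S y ≤ S (x + y) + S (x - y) := by
    intro x y
    have h1 : ∀ d ∈ costSet A B C ρ y, S x ≤ (S (x + y) + S (x - y) - 2 * d) / 2 := fun d hd =>
      csSup_le (hne x) fun c hc => by
        obtain ⟨c', hc', d', hd', h⟩ := exists_costSet_add_ge hc hd
        linarith [hle _ _ hc', hle _ _ hd']
    have h2 : S y ≤ (S (x + y) + S (x - y) - 2 * S x) / 2 :=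
      csSup_le (hne y) fun d hd => by linarith [h1 d hd]
    linarith
  -- The reverse inequality is the first one applied to `x + y` and `x - y`, by homogeneity of
  -- degree 2.
  have hpar : ∀ x y, S (x + y) + S (x - y) = 2 * S x + 2 * S y := by
    intro x y
    refine le_antisymm ?_ (hpar1 x y)
    have h1 := hpar1 (x + y) (x - y)
    rw [show x + y + (x - y) = (2 : ℝ) • x by rw [two_smul]; abel,
      show x + y - (x - y) = (2 : ℝ) • y by rw [two_smul]; abel, hsmul, hsmul] at h1
    linarith
  obtain ⟨P, hPs, hP⟩ := exists_matrix_of_parallelogram hS0 hsmul hpar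
  refine ⟨P, posSemidef_iff_quadForm.2 ⟨hPs, fun x => hP x ▸ hS0 x⟩, fun x w => ?_⟩
  obtain ⟨e, he, rfl⟩ := exists_isTraj_const A B x w
  -- `ψ` is the dissipation rate along the trajectory with constant input. Its integral over every
  -- `[0, h]` is nonpositive, so by continuity `ψ 0 ≤ 0`.
  set ψ : ℝ → ℝ := fun t => 2 * (e t ⬝ᵥ P *ᵥ (A *ᵥ e t + B *ᵥ w))
    + ((C *ᵥ e t) ⬝ᵥ (C *ᵥ e t) - ρ * (w ⬝ᵥ w)) with hψ
  have hψc : Continuous ψ := by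
    have := he.cont
    fun_prop
  have hint : ∀ h, 0 ≤ h → ∫ t in (0 : ℝ)..h, ψ t ≤ 0 := by
    intro h hh
    obtain ⟨h1, h2⟩ := integral_quadForm hPs hh (he.intervalIntegrable_rhs 0 h)
      fun t ht => he.eq_integral ht.1
    rw [hψ, intervalIntegral.integral_add h1 (he.intervalIntegrable_cost C ρ 0 h), h2, ← hP, ← hP]
    have h3 : S (e h) ≤ S (e 0) - cost C ρ e (fun _ => w) h := csSup_le (hne _) fun c hc => by
      linarith [hle _ _ (cost_add_mem_costSet he hh hc)]
    have h4 : cost C ρ e (fun _ => w) h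
        = ∫ t in (0 : ℝ)..h, ((C *ᵥ e t) ⬝ᵥ (C *ᵥ e t) - ρ * (w ⬝ᵥ w)) := rfl
    linarith
  suffices h : ψ 0 ≤ 0 by
    simp only [hψ] at h
    linarith
  by_contra! hpos
  obtain ⟨δ, hδ, hball⟩ := Metric.eventually_nhds_iff.1 (hψc.continuousAt.eventually (lt_mem_nhds hpos))
  refine absurd (hint (δ / 2) (by positivity)) (not_le.2 ?_)
  refine intervalIntegral.intervalIntegral_pos_of_pos_on (hψc.intervalIntegrable _ _) (fun t ht => ?_)
    (by positivity)
  refine hball ?_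
  rw [Real.dist_eq, sub_zero, abs_of_pos ht.1]
  linarith [ht.2]

end Storage

end FaultEst
end

noncomputable section

namespace FaultEst

open MeasureTheory Filter Topology

/-! ### The bounded real lemma -/

section BoundedReal

variable {ι κ σ : Type} [Fintype ι] [DecidableEq ι] [Fintype κ] [Fintype σ]

theorem exists_projection_matrix (V : Submodule ℝ (ι → ℝ)) :
    ∃ π : Matrix ι ι ℝ, (∀ x, π *ᵥ x ∈ V) ∧ ∀ x ∈ V, π *ᵥ x = x := by
  obtain ⟨f, hf⟩ := V.subtype.exists_leftInverse_of_injective V.ker_subtype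
  refine ⟨LinearMap.toMatrix' (V.subtype.comp f), fun x => ?_, fun x hx => ?_⟩
  · rw [← Matrix.toLin'_apply, Matrix.toLin'_toMatrix']
    exact (f x).2
  · rw [← Matrix.toLin'_apply, Matrix.toLin'_toMatrix']
    exact congrArg Subtype.val (LinearMap.congr_fun hf ⟨x, hx⟩)

/-- Applying `π` to an eigenvector gives either an eigenvector of `A` with the same eigenvalue or
zero, and in the latter case the eigenvalue is `-1`. -/
theorem hurwitz_mul_projection {A π : Matrix ι ι ℝ} (hA : Hurwitz A) (hππ : π * π = π)
    (hAπ : π * A * π = A * π) : Hurwitz (A * π - (1 - π)) := by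
  rw [hurwitz_iff_mulVec]
  intro μ v hv he
  have h1 : π * (A * π - (1 - π)) = A * π := by
    rw [mul_sub, mul_sub, mul_one, hππ, sub_self, sub_zero, ← mul_assoc, hAπ]
  have h2 : μ • (toComplex π *ᵥ v) = toComplex A *ᵥ (toComplex π *ᵥ v) := by
    rw [← Matrix.mulVec_smul, ← he, Matrix.mulVec_mulVec, Matrix.mulVec_mulVec, ← toComplex_mul,
      ← toComplex_mul, h1]
  by_cases hπv : toComplex π *ᵥ v = 0
  · rw [toComplex_sub, toComplex_sub, toComplex_mul, toComplex_one, Matrix.sub_mulVec,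
      Matrix.sub_mulVec, ← Matrix.mulVec_mulVec, hπv, Matrix.mulVec_zero, Matrix.one_mulVec,
      sub_zero, zero_sub, ← neg_one_smul ℂ v] at he
    have : μ = -1 := (smul_left_injective ℂ hv he).symm
    rw [this]
    norm_num
  · exact hurwitz_iff_mulVec.1 hA μ _ hπv h2.symm

/-- The bounded real lemma: a finite `L₂`-gain of a stable linear system is certified by a positive
definite quadratic storage function. -/
theorem exists_posDef_of_gain {A : Matrix ι ι ℝ} {B : Matrix ι κ ℝ} {C : Matrix σ ι ℝ} {ρ : ℝ}
    (hA : Hurwitz A) (hρ : 0 < ρ)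
    (hgain : ∀ e w T, 0 ≤ T → IsTraj A B e w → e 0 = 0 → cost C ρ e w T ≤ 0) :
    ∃ P : Matrix ι ι ℝ, P.PosDef ∧ IsDissipative A B C ρ P := by
  have h0 : BddAbove (costSet A B C ρ 0) := by
    refine ⟨0, ?_⟩
    rintro _ ⟨e, w, T, hT, he, he0, rfl⟩
    exact hgain e w T hT he he0
  obtain ⟨π, hπV, hπid⟩ := exists_projection_matrix (finiteStates A B C ρ h0)
  have hππ : π * π = π := Matrix.ext_of_mulVec_single fun i => by
    rw [← Matrix.mulVec_mulVec, hπid _ (hπV _)]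
  have hAπ : π * A * π = A * π := Matrix.ext_of_mulVec_single fun i => by
    rw [mul_assoc, ← Matrix.mulVec_mulVec, ← Matrix.mulVec_mulVec]
    refine hπid _ ?_
    simpa using mulVec_add_mem_finiteStates h0 (hπV (Pi.single i 1)) 0
  have hBπ : π * B = B := by
    classical
    refine Matrix.ext_of_mulVec_single fun i => ?_
    rw [← Matrix.mulVec_mulVec]
    refine hπid _ ?_
    simpa using mulVec_add_mem_finiteStates h0 (Submodule.zero_mem _) (Pi.single i 1)
  have hA' := hurwitz_mul_projection hA hππ hAπ
  -- `π` maps trajectories of the modified system to trajectories of the original one in the finite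
  -- subspace, with the same cost because the output is `C * π`.
  have hfin : ∀ x, BddAbove (costSet (A * π - (1 - π)) B (C * π) ρ x) := by
    intro x
    obtain ⟨M, hM⟩ : BddAbove (costSet A B C ρ (π *ᵥ x)) := hπV x
    refine ⟨M, ?_⟩
    rintro _ ⟨e, w, T, hT, he, rfl, rfl⟩
    refine hM ⟨fun t => π *ᵥ e t, w, T, hT, ⟨?_, he.meas, he.bdd, fun t ht => ?_⟩, rfl, ?_⟩
    · have := he.cont
      fun_prop
    · have h1 := (π.mulVecLin.toContinuousLinearMap).hasFDerivAt.comp_hasDerivWithinAt t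
        (he.deriv t ht)
      have h2 : π *ᵥ ((A * π - (1 - π)) *ᵥ e t + B *ᵥ w t) = A *ᵥ (π *ᵥ e t) + B *ᵥ w t := by
        rw [Matrix.mulVec_add, Matrix.mulVec_mulVec, Matrix.mulVec_mulVec, Matrix.mulVec_mulVec,
          hBπ, mul_sub, mul_sub, mul_one, hππ, sub_self, sub_zero, ← mul_assoc, hAπ]
      rw [← h2]
      exact h1
    · simp only [cost, Matrix.mulVec_mulVec]
  obtain ⟨P, hP, hd, hmin⟩ := exists_trace_minimal (exists_posSemidef_isDissipative hfin)
  obtain ⟨P', hP', hd'⟩ := exists_isDissipative_of_restrict hA hρ hππ hAπ hBπ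
    (posSemidef_iff_quadForm.1 hP).1 hd (re_nonpos_of_trace_minimal hA' hρ hP hd hmin)
  have hP'' : P'.PosSemidef := posSemidef_of_hurwitz hA hP' fun x => by
    have h1 := hd' x 0
    have h2 := dotProduct_self_nonneg (C *ᵥ x)
    simp only [Matrix.mulVec_zero, add_zero, dotProduct_zero, mul_zero, sub_zero] at h1
    linarith
  exact exists_posDef_isDissipative hA hρ hP'' hd'

end BoundedReal

theorem enorm2_le_zero_iff {ι : Type} [Fintype ι] {v : ι → ℝ} : enorm2 v ≤ 0 ↔ v = 0 := by
  rw [enorm2, norm_le_zero_iff, WithLp.toLp_eq_zero]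

/-! ### The linear error dynamics and the equivalence -/

namespace Plant

variable {n m l nvg ng nvη nη nω nf : ℕ} (S : Plant n m l nvg ng nvη nη nω nf) (r : ℕ)

theorem errRhs_of_lipschitz_zero (hLip : S.GaLipschitz 0) (E K : Matrix (St n r nf) (Fin m) ℝ)
    (J : Matrix (Fin nvg ⊕ Fin nvη) (Fin m) ℝ) (x : St n r nf → ℝ) (u : Fin l → ℝ)
    (e : St n r nf → ℝ) (w : Dist nη nω nf → ℝ) {t : ℝ} (ht : 0 ≤ t) :
    S.errRhs r E K J x u e w t = S.Nmat r E K *ᵥ e - (S.Mmat r E * S.Bωa r) *ᵥ w := by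
  have h := hLip (S.Vga r *ᵥ (x + e) + J *ᵥ (S.Ca r *ᵥ x - S.Ca r *ᵥ (x + e))) (S.Vga r *ᵥ x) u t ht
  rw [zero_mul, enorm2_le_zero_iff] at h
  rw [errRhs, h, Matrix.mulVec_zero, add_zero]

/-- With Lipschitz constant 0 the term `δg_a` vanishes, so a trajectory of the linear system driven
by `w` is an error solution for `ω_a = -w` with `x` and `u` set to zero. -/
theorem cost_nonpos_of_l2GainLE (hLip : S.GaLipschitz 0) {E K : Matrix (St n r nf) (Fin m) ℝ}
    {J : Matrix (Fin nvg ⊕ Fin nvη) (Fin m) ℝ} {ρ : ℝ} (hρ : 0 ≤ ρ)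
    (hgain : S.L2GainLE r E K J (√ρ)) {e : ℝ → St n r nf → ℝ} {w : ℝ → Dist nη nω nf → ℝ} {T : ℝ}
    (hT : 0 ≤ T) (he : IsTraj (S.Nmat r E K) (S.Mmat r E * S.Bωa r) e w) (he0 : e 0 = 0) :
    cost (Cbar n r nf) ρ e w T ≤ 0 := by
  have hrhs : ∀ t, 0 ≤ t → S.Nmat r E K *ᵥ e t + (S.Mmat r E * S.Bωa r) *ᵥ w t
      = S.errRhs r E K J 0 0 (e t) (-w t) t := fun t ht => by
    rw [errRhs_of_lipschitz_zero S r hLip _ _ _ _ _ _ _ ht, Matrix.mulVec_neg, sub_neg_eq_add]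
  have hmem : MemLp (fun t => (WithLp.toLp 2 (-w t) : EuclideanSpace ℝ (Dist nη nω nf))) 2
      (volume.restrict (Set.Ioc 0 T)) := by
    have hmeas : Measurable fun t =>
        (WithLp.toLp 2 (-w t) : EuclideanSpace ℝ (Dist nη nω nf)) :=
      (WithLp.measurable_toLp 2 _).comp he.meas.neg
    rw [memLp_two_iff_integrable_sq_norm hmeas.aestronglyMeasurable]
    have h1 := he.intervalIntegrable_input_sq 0 T
    rw [intervalIntegrable_iff_integrableOn_Ioc_of_le hT] at h1
    refine h1.congr (Eventually.of_forall fun t => ?_)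
    have := enorm2_sq (-w t)
    rw [neg_dotProduct_neg] at this
    exact this.symm
  have hsol : S.IsErrSol r E K J T (fun _ => 0) (fun _ => 0) (fun t => -w t) e := by
    refine ⟨(he.intervalIntegrable_rhs 0 T).congr fun t ht => ?_, fun t ht => ?_⟩
    · rw [Set.uIoc_of_le hT] at ht
      exact hrhs t ht.1.le
    · rw [he.eq_integral ht.1]
      congr 1
      refine intervalIntegral.integral_congr fun s hs => ?_
      rw [Set.uIcc_of_le ht.1] at hs
      exact hrhs s hs.1
  have h := hgain T hT _ hmem _ _ e hsol he0
  simp only [enorm2_sq, Real.sq_sqrt hρ, neg_dotProduct_neg] at h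
  have hC : Continuous fun t => (Cbar n r nf *ᵥ e t) ⬝ᵥ (Cbar n r nf *ᵥ e t) := by
    have := he.cont
    fun_prop
  rw [cost, intervalIntegral.integral_sub (hC.intervalIntegrable _ _)
    ((he.intervalIntegrable_input_sq 0 T).const_mul ρ), intervalIntegral.integral_const_mul]
  linarith

theorem l2GainLE_of_reducedLMI (hLip : S.GaLipschitz 0) {ρ : ℝ} (hρ : 0 ≤ ρ)
    {P : Matrix (St n r nf) (St n r nf) ℝ} {R Q : Matrix (St n r nf) (Fin m) ℝ}
    (J : Matrix (Fin nvg ⊕ Fin nvη) (Fin m) ℝ) (hP : P.PosDef) (h : S.ReducedLMI r P R Q ρ) :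
    S.L2GainLE r (P⁻¹ * R) (P⁻¹ * Q) J (√ρ) := by
  refine l2GainLE_of_fullLMI S r le_rfl hLip one_pos hρ hP ((fullLMI_zero_iff S r one_pos J hP).2 ?_)
  rwa [inv_one, one_smul, one_smul, one_smul]

theorem l2GainLE_iff_exists_reducedLMI (hLip : S.GaLipschitz 0)
    {E K : Matrix (St n r nf) (Fin m) ℝ} (J : Matrix (Fin nvg ⊕ Fin nvη) (Fin m) ℝ) {ρ : ℝ}
    (hN : Hurwitz (S.Nmat r E K)) (hρ : 0 < ρ) :
    S.L2GainLE r E K J (√ρ) ↔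
      ∃ P : Matrix (St n r nf) (St n r nf) ℝ, P.PosDef ∧ S.ReducedLMI r P (P * E) (P * K) ρ := by
  constructor
  · intro hgain
    obtain ⟨P, hP, hd⟩ := exists_posDef_of_gain (C := Cbar n r nf) hN hρ
      fun e w T hT he he0 => cost_nonpos_of_l2GainLE S r hLip hρ.le hgain hT he he0
    exact ⟨P, hP, (reducedLMI_iff_isDissipative S r (posDef_iff_quadForm.1 hP).1 E K ρ).2 hd⟩
  · rintro ⟨P, hP, h⟩
    have hdet : IsUnit P.det := (Matrix.isUnit_iff_isUnit_det P).1 hP.isUnit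
    have := l2GainLE_of_reducedLMI S r hLip hρ.le J hP h
    rwa [Matrix.nonsing_inv_mul_cancel_left P _ hdet,
      Matrix.nonsing_inv_mul_cancel_left P _ hdet] at this

end Plant

end FaultEst
end

theorem proposition2 {n m l nvg ng nvη nη nω nf : ℕ}
    (S : FaultEst.Plant n m l nvg ng nvη nη nω nf) (r : ℕ) (hr : 1 ≤ r)
    (α : ℝ) (hα : 0 ≤ α) (hLip : S.GaLipschitz α) :
    -- sufficiency of the matrix inequality
    (∀ (a : ℝ), 0 < a →
      ∀ (P : Matrix (FaultEst.St n r nf) (FaultEst.St n r nf) ℝ)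
        (R Q : Matrix (FaultEst.St n r nf) (Fin m) ℝ)
        (J : Matrix (Fin nvg ⊕ Fin nvη) (Fin m) ℝ) (ρ : ℝ),
        P.PosDef → 0 ≤ ρ → S.FullLMI r α a P R Q J ρ →
          S.L2GainLE r (P⁻¹ * R) (P⁻¹ * Q) J (Real.sqrt ρ)) ∧
    -- the case without nonlinearity
    (α = 0 →
      -- the matrix inequality becomes the reduced one (after dividing `P, R, Q` by `a`)
      (∀ (a : ℝ), 0 < a →
        ∀ (P : Matrix (FaultEst.St n r nf) (FaultEst.St n r nf) ℝ)
          (R Q : Matrix (FaultEst.St n r nf) (Fin m) ℝ)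
          (J : Matrix (Fin nvg ⊕ Fin nvη) (Fin m) ℝ) (ρ : ℝ),
          P.PosDef → 0 ≤ ρ →
            (S.FullLMI r α a P R Q J ρ ↔ S.ReducedLMI r (a⁻¹ • P) (a⁻¹ • R) (a⁻¹ • Q) ρ)) ∧
      -- the reduced inequality is sufficient
      (∀ (P : Matrix (FaultEst.St n r nf) (FaultEst.St n r nf) ℝ)
        (R Q : Matrix (FaultEst.St n r nf) (Fin m) ℝ)
        (J : Matrix (Fin nvg ⊕ Fin nvη) (Fin m) ℝ) (ρ : ℝ),
        P.PosDef → 0 ≤ ρ → S.ReducedLMI r P R Q ρ →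
          S.L2GainLE r (P⁻¹ * R) (P⁻¹ * Q) J (Real.sqrt ρ)) ∧
      -- for given gains with stable error dynamics it is necessary and sufficient
      (∀ (E K : Matrix (FaultEst.St n r nf) (Fin m) ℝ)
        (J : Matrix (Fin nvg ⊕ Fin nvη) (Fin m) ℝ) (ρ : ℝ),
        FaultEst.Hurwitz (S.Nmat r E K) → 0 < ρ →
          (S.L2GainLE r E K J (Real.sqrt ρ) ↔
            ∃ (P : Matrix (FaultEst.St n r nf) (FaultEst.St n r nf) ℝ)
              (R Q : Matrix (FaultEst.St n r nf) (Fin m) ℝ),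
              P.PosDef ∧ R = P * E ∧ Q = P * K ∧ S.ReducedLMI r P R Q ρ))) := by
  refine ⟨fun a ha P R Q J ρ hP hρ h =>
    FaultEst.Plant.l2GainLE_of_fullLMI S r hα hLip ha hρ hP h, ?_⟩
  rintro rfl
  refine ⟨fun a ha P R Q J ρ hP _ => FaultEst.Plant.fullLMI_zero_iff S r ha J hP,
    fun P R Q J ρ hP hρ h => FaultEst.Plant.l2GainLE_of_reducedLMI S r hLip hρ J hP h,
    fun E K J ρ hN hρ => ?_⟩
  rw [FaultEst.Plant.l2GainLE_iff_exists_reducedLMI S r hLip J hN hρ]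
  constructor
  · rintro ⟨P, hP, h⟩
    exact ⟨P, _, _, hP, rfl, rfl, h⟩
  · rintro ⟨P, _, _, hP, rfl, rfl, h⟩
    exact ⟨P, hP, h⟩
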